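/- For $\alpha>0$ and $z$ in the upper half-plane $\mathbb{H}=\{z=x+iy : y>0\}$ let $$M(\alpha,z)=\sum_{(m,n)\in\mathbb{Z}^2}\frac{|mz+n|^2}{\Im(z)}\,e^{-\pi\alpha\frac{|mz+n|^2}{\Im(z)}}.$$ Let $\mathcal{D}_{\mathcal{G}}=\{z\in\mathbb{H} : |z|>1,\ 0<\Re(z)<\tfrac12\}$, with closure $\overline{\mathcal{D}_{\mathcal{G}}}$ in $\mathbb{H}$, and let $\Gamma=\Gamma_a\cup\Gamma_b$, where $$\Gamma_a=\{iy : y\ge 1\},\qquad \Gamma_b=\{e^{i\theta} : \theta\in[\tfrac{\pi}{3},\tfrac{\pi}{2}]\}.$$ Then for every $\alpha\in(0,\,0.9155730607)$ the following three minima exist (are attained) and are equal: $$\min_{z\in\mathbb{H}}M(\alpha,z)=\min_{z\in\overline{\mathcal{D}_{\mathcal{G}}}}M(\alpha,z)=\min_{z\in\Gamma}M(\alpha,z).$$ -/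

import Mathlib

open scoped UpperHalfPlane

/-- The lattice sum `M(α, z) = ∑_{(m,n) ∈ ℤ²} (|mz+n|² / Im z) · exp(-πα |mz+n|² / Im z)`,
which is `∑_{P ∈ L} |P|² exp(-πα|P|²)` for the unit-density lattice
`L = (Im z)^{-1/2} (ℤ ⊕ zℤ)`. -/
noncomputable def latticeM (α : ℝ) (z : ℍ) : ℝ :=
  ∑' p : ℤ × ℤ, ‖(p.1 : ℂ) * (z : ℂ) + (p.2 : ℂ)‖ ^ 2 / z.im *
    Real.exp (-Real.pi * α * (‖(p.1 : ℂ) * (z : ℂ) + (p.2 : ℂ)‖ ^ 2 / z.im))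

/-- The series defining `latticeM` converges for every `α > 0`. -/
theorem summable_latticeM {α : ℝ} (hα : 0 < α) (z : ℍ) :
    Summable fun p : ℤ × ℤ => ‖(p.1 : ℂ) * (z : ℂ) + (p.2 : ℂ)‖ ^ 2 / z.im *
      Real.exp (-Real.pi * α * (‖(p.1 : ℂ) * (z : ℂ) + (p.2 : ℂ)‖ ^ 2 / z.im)) := by
  have hc : 0 < Real.pi * α := mul_pos Real.pi_pos hα
  have hs : Summable fun x : ℤ × ℤ => ‖(![x.1, x.2] : Fin 2 → ℤ)‖ ^ (-(4 : ℝ)) :=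
    ((finTwoArrowEquiv ℤ).symm.summable_iff).2
      (EisensteinSeries.summable_one_div_norm_rpow (k := 4) (by norm_num))
  refine Summable.of_nonneg_of_le (fun p => ?_) (fun p => ?_)
    (hs.mul_left (6 / (Real.pi * α) ^ 3 * z.im ^ 2 * EisensteinSeries.r z ^ (-(4 : ℝ))))
  · have := z.im_pos
    positivity
  · have hb := EisensteinSeries.summand_bound z (k := 4) (by norm_num) ![p.1, p.2]
    simp only [Matrix.cons_val_zero, Matrix.cons_val_one] at hb
    set w := ‖(p.1 : ℂ) * (z : ℂ) + (p.2 : ℂ)‖ with hw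
    have hy := z.im_pos
    have hw0 : 0 ≤ w := norm_nonneg _
    rw [mul_assoc _ (EisensteinSeries.r z ^ (-(4 : ℝ)))]
    refine le_trans ?_ (mul_le_mul_of_nonneg_left hb (by positivity))
    rcases hw0.eq_or_lt with h | h
    · rw [← h]; simp
    · have hq : 0 < w ^ 2 / z.im := by positivity
      have he := Real.pow_div_factorial_le_exp (Real.pi * α * (w ^ 2 / z.im)) (by positivity) 3
      have hr : w ^ (-(4 : ℝ)) = (w ^ 4)⁻¹ := by
        rw [Real.rpow_neg hw0]; norm_cast
      rw [hr, neg_mul, neg_mul, Real.exp_neg, ← div_eq_mul_inv,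
        div_le_iff₀ (Real.exp_pos _)]
      calc w ^ 2 / z.im = 6 / (Real.pi * α) ^ 3 * z.im ^ 2 * (w ^ 4)⁻¹ *
            ((Real.pi * α * (w ^ 2 / z.im)) ^ 3 / (Nat.factorial 3 : ℕ)) := by
            have h6 : ((Nat.factorial 3 : ℕ) : ℝ) = 6 := by norm_num [Nat.factorial]
            rw [h6]
            field_simp
        _ ≤ _ := mul_le_mul_of_nonneg_left he (by positivity)

/-- The open right-half fundamental domain `{z ∈ ℍ : |z| > 1, 0 < Re z < 1/2}`. -/
def halfFundamentalDomain : Set ℍ :=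
  {z | 1 < ‖(z : ℂ)‖ ∧ 0 < z.re ∧ z.re < 1 / 2}

/-- The vertical half-line `Γ_a = {iy : y ≥ 1}`. -/
def gammaA : Set ℍ :=
  {z | ∃ y : ℝ, 1 ≤ y ∧ (z : ℂ) = Complex.I * y}

/-- The arc `Γ_b = {e^{iθ} : θ ∈ [π/3, π/2]}`. -/
def gammaB : Set ℍ :=
  {z | ∃ t ∈ Set.Icc (Real.pi / 3) (Real.pi / 2), (z : ℂ) = Complex.exp (Complex.I * t)}

open scoped FourierTransform

/-! ### Gaussian sums over `ℤ` and Poisson summation -/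

/-! The sum is invariant under `SL(2, ℤ)` and under reflection in the imaginary axis, lower
semicontinuous, and unbounded as `Im z → ∞`, so it attains its minimum at a point of the closed half
fundamental domain. By `exists_isLeast_of_dominated` it remains to dominate every point of that
domain by a point of `Γ`.

The tool is the Fourier series in `x = Re z` obtained by Poisson summation on each row
(`sq_mul_latticeM`): with `X = αy` and `Z = y/α`, `α² M = √X ∑ (1/(2π) + Xm² - Zk²) exp(-π(Xm² +
Zk²)) cos(2πmkx)`. The terms `m, k = ±1` carry the coefficient `-ω`, where `ω = Z - X - 1/(2π)`.
When `ω` is not too small, `-ω cos(2πx)` governs the variation in `x`, and `M` decreases as `z`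
moves left until it meets `Γ_a` (if `y ≥ 1`) or `Γ_b` (if `y < 1`). The other terms are controlled
by `|cos nu - cos nv| ≤ n² |cos u - cos v|`. For `ω` near `0`, even slightly negative, the `(2, 1)`
term has the favourable sign near `x = 1/2` and saves the argument (`latticeM_le_of_horizontal`).

Two regions escape. If `ω < -0.0018`, then `z` is close to the hexagonal point and `α ≥ 0.913`;
there the upper bound on `α` makes the square lattice better (`latticeM_I_le_of_near_hexagonal`). If
`αy ≤ 1/4`, the rectangular lattice with `z = i/α` is better (`sq_mul_latticeM_le`,
`le_sq_mul_latticeM`). -/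

theorem summable_pow_mul_gaussian {a : ℝ} (ha : 0 < a) (j : ℕ) :
    Summable fun n : ℤ => |(n : ℝ)| ^ j * Real.exp (-Real.pi * a * (n : ℝ) ^ 2) := by
  have h := summable_pow_mul_jacobiTheta₂_term_bound 0 ha j
  refine h.congr fun n => ?_
  push_cast
  congr 2
  ring

theorem integrable_pow_mul_cexp_gaussian {a : ℝ} (ha : 0 < a) (n : ℕ) :
    MeasureTheory.Integrable fun x : ℝ =>
      x ^ n • Complex.exp (-Real.pi * a * (x : ℂ) ^ 2) := by
  have h := integrable_rpow_mul_exp_neg_mul_sq (b := Real.pi * a) (by positivity)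
    (s := n) (by have : (0 : ℝ) ≤ n := n.cast_nonneg
                 linarith)
  refine (h.ofReal (𝕜 := ℂ)).congr (Filter.Eventually.of_forall fun x => ?_)
  simp only [Real.rpow_natCast]
  rw [Complex.real_smul]
  rw [RCLike.ofReal_mul]
  simp only [RCLike.ofReal_pow, Complex.coe_algebraMap, Complex.ofReal_pow]
  congr 1
  refine (Complex.ofReal_exp _).trans ?_
  push_cast
  congr 1
  ring

theorem fourier_sq_mul_gaussian {a : ℝ} (ha : 0 < a) :
    (𝓕 fun x : ℝ => (x : ℂ) ^ 2 * Complex.exp (-Real.pi * a * (x : ℂ) ^ 2)) =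
      fun t : ℝ => 1 / (a : ℂ) ^ (1 / 2 : ℂ) * ((1 / (2 * Real.pi * a) - (t : ℂ) ^ 2 / a ^ 2) *
        Complex.exp (-Real.pi / a * (t : ℂ) ^ 2)) := by
  have hac : (a : ℂ) ≠ 0 := by exact_mod_cast ha.ne'
  have hpi : (Real.pi : ℂ) ≠ 0 := by exact_mod_cast Real.pi_ne_zero
  -- Differentiating the transform twice brings down `(-2πix)² = -4π²x²`, so the transform sought is
  -- the second derivative of the Gaussian's transform divided by `-4π²`.
  have h := Real.iteratedDeriv_fourier (f := fun x : ℝ => Complex.exp (-Real.pi * a * (x : ℂ) ^ 2))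
    (N := 2) (n := 2) (fun n _ => integrable_pow_mul_cexp_gaussian ha n) le_rfl
  have hre : 0 < ((a : ℂ)).re := by simpa using ha
  rw [fourier_gaussian_pi hre] at h
  set K : ℂ := 1 / (a : ℂ) ^ (1 / 2 : ℂ) with hK
  set G : ℝ → ℂ := fun t => Complex.exp (-Real.pi / a * (t : ℂ) ^ 2) with hG
  have hd1 : ∀ t : ℝ, HasDerivAt G ((-2 * Real.pi / a * t) * G t) t := by
    intro t
    have h1 : HasDerivAt (fun t : ℝ => (-Real.pi / a * (t : ℂ) ^ 2 : ℂ))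
        (-2 * Real.pi / a * t) t := by
      have := ((hasDerivAt_id t).ofReal_comp.pow 2).const_mul (-Real.pi / a : ℂ)
      convert! this using 1
      simp
      ring
    have := h1.cexp
    convert! this using 1
    simp only [hG]
    ring
  have hd2 : iteratedDeriv 2 (fun t => K * G t) = fun t : ℝ =>
      K * ((-2 * Real.pi / a + (2 * Real.pi / a) ^ 2 * (t : ℂ) ^ 2) * G t) := by
    rw [iteratedDeriv_succ, iteratedDeriv_one]
    have e1 : deriv (fun t => K * G t) = fun t : ℝ => K * ((-2 * Real.pi / a * t) * G t) :=
      funext fun t => ((hd1 t).const_mul K).deriv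
    rw [e1]
    funext t
    have h2 : HasDerivAt (fun t : ℝ => (-2 * Real.pi / a * (t : ℂ) : ℂ)) (-2 * Real.pi / a) t := by
      simpa using (hasDerivAt_id t).ofReal_comp.const_mul (-2 * Real.pi / a : ℂ)
    refine ((h2.mul (hd1 t)).const_mul K).deriv.trans ?_
    ring
  rw [hd2] at h
  have hlin : (fun x : ℝ => (-2 * (Real.pi : ℂ) * Complex.I * x) ^ 2 •
      Complex.exp (-Real.pi * a * (x : ℂ) ^ 2)) = (-(4 * (Real.pi : ℂ) ^ 2)) •
      fun x : ℝ => (x : ℂ) ^ 2 * Complex.exp (-Real.pi * a * (x : ℂ) ^ 2) := by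
    funext x
    simp only [smul_eq_mul, Pi.smul_apply]
    have := Complex.I_sq
    linear_combination (4 * (Real.pi : ℂ) ^ 2 * x ^ 2 *
      Complex.exp (-Real.pi * a * (x : ℂ) ^ 2)) * this
  rw [hlin] at h
  funext t
  have h3 := congrFun h t
  have h4 : (𝓕 ((-(4 * (Real.pi : ℂ) ^ 2)) •
      fun x : ℝ => (x : ℂ) ^ 2 * Complex.exp (-Real.pi * a * (x : ℂ) ^ 2))) t =
      (-(4 * (Real.pi : ℂ) ^ 2)) • (𝓕 fun x : ℝ =>
        (x : ℂ) ^ 2 * Complex.exp (-Real.pi * a * (x : ℂ) ^ 2)) t := by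
    rw [Real.fourier_eq, Real.fourier_eq, ← MeasureTheory.integral_smul]
    congr 1
    funext v
    simp only [Pi.smul_apply]
    rw [smul_comm]
  rw [h4, smul_eq_mul] at h3
  have h5 : (-(4 * (Real.pi : ℂ) ^ 2)) ≠ 0 := by simp [hpi]
  apply mul_left_cancel₀ h5
  rw [← h3]
  simp only [hG]
  field_simp
  ring

theorem isBigO_pow_mul_gaussian {a : ℝ} (ha : 0 < a) (j : ℕ) :
    (fun x : ℝ => (x : ℂ) ^ j * Complex.exp (-Real.pi * a * (x : ℂ) ^ 2)) =O[Filter.cocompact ℝ]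
      fun x : ℝ => |x| ^ (-2 : ℝ) := by
  have h := (isLittleO_exp_neg_mul_sq_cocompact (a := Real.pi * a)
    (by rw [← Complex.ofReal_mul, Complex.ofReal_re]; positivity) (-2 - j)).isBigO
  have h2 := (Asymptotics.isBigO_refl (fun x : ℝ => (x : ℂ) ^ j) (Filter.cocompact ℝ)).norm_right.mul h
  have h3 : (fun x : ℝ => (x : ℂ) ^ j * Complex.exp (-Real.pi * a * (x : ℂ) ^ 2)) =
      fun x : ℝ => (x : ℂ) ^ j * Complex.exp (-(Real.pi * a) * (x : ℂ) ^ 2) := by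
    funext x
    congr 2
    ring
  rw [h3]
  refine h2.trans ?_
  refine Asymptotics.IsBigO.of_bound 1 ?_
  have hne : ∀ᶠ x : ℝ in Filter.cocompact ℝ, x ≠ 0 := by
    have := (Set.finite_singleton (0 : ℝ)).isCompact.compl_mem_cocompact
    filter_upwards [this] with x hx
    simpa using hx
  filter_upwards [hne] with x hx
  have hx' : 0 < |x| := abs_pos.2 hx
  rw [one_mul, norm_mul, norm_norm, norm_pow, Complex.norm_real,
    Real.norm_of_nonneg (Real.rpow_nonneg hx'.le _),
    Real.norm_of_nonneg (Real.rpow_nonneg hx'.le _), Real.norm_eq_abs, ← Real.rpow_natCast,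
    ← Real.rpow_add hx']
  apply le_of_eq
  congr 1
  ring

theorem cpow_half_ofReal {a : ℝ} (ha : 0 < a) : (a : ℂ) ^ (1 / 2 : ℂ) = ((√a : ℝ) : ℂ) := by
  rw [Real.sqrt_eq_rpow, Complex.ofReal_cpow ha.le]
  norm_num

theorem re_ofReal_mul_fourier (c t : ℝ) (n : ℤ) :
    ((c : ℂ) * fourier n (t : UnitAddCircle)).re = c * Real.cos (2 * Real.pi * n * t) := by
  rw [fourier_coe_apply, Complex.re_ofReal_mul]
  congr 1
  have : (2 * (Real.pi : ℂ) * Complex.I * n * t / (1 : ℝ)) =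
      ((2 * Real.pi * n * t : ℝ) : ℂ) * Complex.I := by
    push_cast
    ring
  rw [this, Complex.exp_ofReal_mul_I_re]

theorem tsum_re_poisson {F : ℤ → ℝ} (hF : Summable F) (t S : ℝ)
    (h : (S : ℂ) = ∑' n : ℤ, (F n : ℂ) * fourier n (t : UnitAddCircle)) :
    S = ∑' n : ℤ, F n * Real.cos (2 * Real.pi * n * t) := by
  have hs : Summable fun n : ℤ => (F n : ℂ) * fourier n (t : UnitAddCircle) := by
    refine Summable.of_norm_bounded hF.abs fun n => ?_
    rw [norm_mul, Complex.norm_real, Real.norm_eq_abs]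
    exact mul_le_of_le_one_right (abs_nonneg _) ((ContinuousMap.norm_coe_le_norm _ _).trans (fourier_norm n).le)
  have h2 := congrArg Complex.re h
  rw [Complex.ofReal_re, Complex.re_tsum hs] at h2
  rw [h2]
  exact tsum_congr fun n => re_ofReal_mul_fourier _ _ _

theorem summable_gaussian_dual {a : ℝ} (ha : 0 < a) (u v : ℝ) :
    Summable fun n : ℤ => (u + v * (n : ℝ) ^ 2) * Real.exp (-Real.pi / a * (n : ℝ) ^ 2) := by
  have h0 := (summable_pow_mul_gaussian (inv_pos.2 ha) 0).mul_left u
  have h2 := (summable_pow_mul_gaussian (inv_pos.2 ha) 2).mul_left v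
  refine (h0.add h2).congr fun n => ?_
  rw [sq_abs, div_eq_mul_inv]
  ring

/-- Poisson summation for a Gaussian. -/
theorem tsum_gaussian_shift {a : ℝ} (ha : 0 < a) (t : ℝ) :
    ∑' n : ℤ, Real.exp (-Real.pi * a * (t + n) ^ 2) =
      ∑' n : ℤ, ((√a)⁻¹ * Real.exp (-Real.pi / a * (n : ℝ) ^ 2)) *
        Real.cos (2 * Real.pi * n * t) := by
  have hF : Summable fun n : ℤ => (√a)⁻¹ * Real.exp (-Real.pi / a * (n : ℝ) ^ 2) := by
    refine ((summable_gaussian_dual ha 1 0).mul_left (√a)⁻¹).congr fun n => ?_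
    ring
  refine tsum_re_poisson hF t _ ?_
  have hre : 0 < ((a : ℂ)).re := by simpa using ha
  have hft := fourier_gaussian_pi hre
  have h := Real.tsum_eq_tsum_fourier_of_rpow_decay_of_summable
    (f := fun x : ℝ => Complex.exp (-Real.pi * a * (x : ℂ) ^ 2)) (by fun_prop) one_lt_two
    (by simpa using isBigO_pow_mul_gaussian ha 0)
    (by
      rw [hft]
      refine (Complex.hasSum_ofReal.2 hF.hasSum).summable.congr fun n => ?_
      rw [cpow_half_ofReal ha]
      push_cast
      ring) t
  rw [hft] at h
  rw [Complex.ofReal_tsum]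
  convert! h using 1
  · refine tsum_congr fun n => ?_
    push_cast
    rfl
  · refine tsum_congr fun n => ?_
    rw [cpow_half_ofReal ha]
    push_cast
    ring

/-- Poisson summation for a Gaussian multiplied by the square of the variable. -/
theorem tsum_sq_mul_gaussian_shift {a : ℝ} (ha : 0 < a) (t : ℝ) :
    ∑' n : ℤ, (t + n) ^ 2 * Real.exp (-Real.pi * a * (t + n) ^ 2) =
      ∑' n : ℤ, ((√a)⁻¹ * ((1 / (2 * Real.pi * a) - (n : ℝ) ^ 2 / a ^ 2) *
        Real.exp (-Real.pi / a * (n : ℝ) ^ 2))) * Real.cos (2 * Real.pi * n * t) := by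
  have hF : Summable fun n : ℤ => (√a)⁻¹ * ((1 / (2 * Real.pi * a) - (n : ℝ) ^ 2 / a ^ 2) *
        Real.exp (-Real.pi / a * (n : ℝ) ^ 2)) := by
    refine ((summable_gaussian_dual ha (1 / (2 * Real.pi * a)) (-(1 / a ^ 2))).mul_left
      (√a)⁻¹).congr fun n => ?_
    ring
  refine tsum_re_poisson hF t _ ?_
  have hft := fourier_sq_mul_gaussian ha
  have h := Real.tsum_eq_tsum_fourier_of_rpow_decay_of_summable
    (f := fun x : ℝ => (x : ℂ) ^ 2 * Complex.exp (-Real.pi * a * (x : ℂ) ^ 2)) (by fun_prop)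
    one_lt_two (isBigO_pow_mul_gaussian ha 2)
    (by
      rw [hft]
      refine (Complex.hasSum_ofReal.2 hF.hasSum).summable.congr fun n => ?_
      rw [cpow_half_ofReal ha]
      push_cast
      ring) t
  rw [hft] at h
  rw [Complex.ofReal_tsum]
  convert! h using 1
  · refine tsum_congr fun n => ?_
    push_cast
    rfl
  · refine tsum_congr fun n => ?_
    rw [cpow_half_ofReal ha]
    push_cast
    ring

/-! ### The Fourier expansion of the lattice sum -/

/-- The Fourier coefficient of index `(m, k)` of `√X⁻¹ α² M(α, z)`, where `X = α Im z` and
`Z = Im z / α`. -/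
noncomputable def fourierCoeffM (X Z m k : ℝ) : ℝ :=
  (1 / (2 * Real.pi) + X * m ^ 2 - Z * k ^ 2) * Real.exp (-Real.pi * (X * m ^ 2 + Z * k ^ 2))

theorem sq_norm_mul_add (z : ℍ) (m n : ℤ) :
    ‖(m : ℂ) * (z : ℂ) + (n : ℂ)‖ ^ 2 = (m * z.re + n) ^ 2 + (m * z.im) ^ 2 := by
  rw [← Complex.normSq_eq_norm_sq, Complex.normSq_apply]
  simp
  ring

theorem summable_fourierCoeffM {X Z : ℝ} (hX : 0 < X) (hZ : 0 < Z) :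
    Summable fun p : ℤ × ℤ => fourierCoeffM X Z p.1 p.2 := by
  have h0 := summable_pow_mul_gaussian hX 0
  have h2 := summable_pow_mul_gaussian hX 2
  have k0 := summable_pow_mul_gaussian hZ 0
  have k2 := summable_pow_mul_gaussian hZ 2
  have n (a : ℝ) (j : ℕ) : 0 ≤ fun n : ℤ => |(n : ℝ)| ^ j *
      Real.exp (-Real.pi * a * (n : ℝ) ^ 2) := fun n => by positivity
  have s1 := (h0.mul_of_nonneg k0 (n X 0) (n Z 0)).mul_left (1 / (2 * Real.pi))
  have s2 := (h2.mul_of_nonneg k0 (n X 2) (n Z 0)).mul_left X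
  have s3 := (h0.mul_of_nonneg k2 (n X 0) (n Z 2)).mul_left Z
  refine ((s1.add s2).sub s3).congr fun p => ?_
  rw [fourierCoeffM, mul_add (-Real.pi), Real.exp_add]
  simp only [sq_abs, pow_zero]
  ring_nf

theorem summable_fourierCoeffM_mul_cos {X Z : ℝ} (hX : 0 < X) (hZ : 0 < Z) (x : ℝ) :
    Summable fun p : ℤ × ℤ => fourierCoeffM X Z p.1 p.2 *
      Real.cos (2 * Real.pi * p.1 * p.2 * x) := by
  refine Summable.of_norm_bounded (summable_fourierCoeffM hX hZ).abs fun p => ?_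
  rw [norm_mul, Real.norm_eq_abs, Real.norm_eq_abs]
  exact mul_le_of_le_one_right (abs_nonneg _) (Real.abs_cos_le_one _)

/-- Dropping `t²` from `(t + n)²` and bounding the cross term by `2|t||n|` gives the shape of
`summable_pow_mul_jacobiTheta₂_term_bound`. -/
theorem exp_shift_gaussian_le {a : ℝ} (ha : 0 < a) (t : ℝ) (n : ℤ) :
    Real.exp (-Real.pi * a * (t + n) ^ 2) ≤
      Real.exp (-Real.pi * (a * n ^ 2 - 2 * (a * |t|) * |n|)) := by
  apply Real.exp_le_exp.2
  have h : (n : ℝ) ^ 2 - 2 * |t| * |(n : ℝ)| ≤ (t + n) ^ 2 := by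
    have := neg_abs_le (t * n)
    rw [abs_mul] at this
    nlinarith [sq_nonneg t]
  have h2 := mul_le_mul_of_nonneg_left h (mul_pos Real.pi_pos ha).le
  push_cast
  linarith

theorem summable_exp_shift_gaussian {a : ℝ} (ha : 0 < a) (t : ℝ) :
    Summable fun n : ℤ => Real.exp (-Real.pi * a * (t + n) ^ 2) := by
  refine Summable.of_nonneg_of_le (fun n => (Real.exp_pos _).le) (fun n => ?_)
    (summable_pow_mul_jacobiTheta₂_term_bound (a * |t|) ha 0)
  rw [pow_zero, one_mul]
  exact exp_shift_gaussian_le ha t n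

theorem summable_shift_gaussian {a : ℝ} (ha : 0 < a) (t : ℝ) :
    Summable fun n : ℤ => (t + n) ^ 2 * Real.exp (-Real.pi * a * (t + n) ^ 2) := by
  refine Summable.of_nonneg_of_le (fun n => by positivity) (fun n => ?_)
    (((summable_pow_mul_jacobiTheta₂_term_bound (a * |t|) ha 0).mul_left (2 * t ^ 2)).add
      ((summable_pow_mul_jacobiTheta₂_term_bound (a * |t|) ha 2).mul_left 2))
  have h : (t + n) ^ 2 ≤ 2 * t ^ 2 + 2 * (n : ℝ) ^ 2 := by nlinarith [sq_nonneg (t - n)]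
  refine (mul_le_mul h (exp_shift_gaussian_le ha t n) (Real.exp_pos _).le (by positivity)).trans
    (le_of_eq ?_)
  push_cast
  rw [sq_abs]
  ring

/-- Poisson summation along one row of the lattice. -/
theorem tsum_row (α x y : ℝ) (hα : 0 < α) (hy : 0 < y) (m : ℤ) :
    α ^ 2 * ∑' n : ℤ, ((m * x + n) ^ 2 + (m * y) ^ 2) / y *
        Real.exp (-Real.pi * α * (((m * x + n) ^ 2 + (m * y) ^ 2) / y)) =
      √(α * y) * ∑' k : ℤ, fourierCoeffM (α * y) (y / α) m k *
        Real.cos (2 * Real.pi * m * k * x) := by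
  have ha : 0 < α / y := by positivity
  have hs0 := summable_exp_shift_gaussian ha (m * x)
  have hs2 := summable_shift_gaussian ha (m * x)
  have e1 := tsum_gaussian_shift ha (m * x)
  have e2 := tsum_sq_mul_gaussian_shift ha (m * x)
  -- The squared length splits as `(mx + n)²/y + m²y`, so the row is a fixed factor times Gaussian
  -- moments of order `0` and `2` in `n`, with parameter `α/y` and shift `mx`.
  have hL : ∑' n : ℤ, ((m * x + n) ^ 2 + (m * y) ^ 2) / y *
        Real.exp (-Real.pi * α * (((m * x + n) ^ 2 + (m * y) ^ 2) / y)) =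
      Real.exp (-Real.pi * (α * y * m ^ 2)) * (1 / y *
        (∑' n : ℤ, (m * x + n) ^ 2 * Real.exp (-Real.pi * (α / y) * (m * x + n) ^ 2)) +
        m ^ 2 * y * ∑' n : ℤ, Real.exp (-Real.pi * (α / y) * (m * x + n) ^ 2)) := by
    rw [← tsum_mul_left, ← tsum_mul_left, ← (hs2.mul_left _).tsum_add (hs0.mul_left _),
      ← tsum_mul_left]
    refine tsum_congr fun n => ?_
    have : Real.exp (-Real.pi * α * (((m * x + n) ^ 2 + (m * y) ^ 2) / y)) =
        Real.exp (-Real.pi * (α * y * m ^ 2)) *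
          Real.exp (-Real.pi * (α / y) * (m * x + n) ^ 2) := by
      rw [← Real.exp_add]
      congr 1
      field_simp
      ring
    rw [this]
    field_simp
  have hcos (f : ℤ → ℝ) (hf : Summable f) :
      Summable fun n : ℤ => f n * Real.cos (2 * Real.pi * n * (m * x)) := by
    refine Summable.of_norm_bounded hf.abs fun p => ?_
    rw [norm_mul, Real.norm_eq_abs, Real.norm_eq_abs]
    exact mul_le_of_le_one_right (abs_nonneg _) (Real.abs_cos_le_one _)
  have hd0 : Summable fun n : ℤ => ((√(α / y))⁻¹ * Real.exp (-Real.pi / (α / y) * (n : ℝ) ^ 2)) *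
      Real.cos (2 * Real.pi * n * (m * x)) := by
    refine hcos _ (((summable_gaussian_dual ha 1 0).mul_left (√(α / y))⁻¹).congr fun n => ?_)
    ring
  have hd2 : Summable fun n : ℤ => ((√(α / y))⁻¹ *
      ((1 / (2 * Real.pi * (α / y)) - (n : ℝ) ^ 2 / (α / y) ^ 2) *
        Real.exp (-Real.pi / (α / y) * (n : ℝ) ^ 2))) *
      Real.cos (2 * Real.pi * n * (m * x)) := by
    refine hcos _ (((summable_gaussian_dual ha (1 / (2 * Real.pi * (α / y)))
      (-(1 / (α / y) ^ 2))).mul_left (√(α / y))⁻¹).congr fun n => ?_)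
    ring
  rw [hL, e1, e2, ← tsum_mul_left, ← tsum_mul_left, ← (hd2.mul_left _).tsum_add (hd0.mul_left _),
    ← tsum_mul_left, ← tsum_mul_left, ← tsum_mul_left]
  refine tsum_congr fun k => ?_
  have hq : (√(α / y))⁻¹ = √(α * y) / α := by
    rw [← Real.sqrt_inv, inv_div, ← Real.sqrt_sq hα.le, ← Real.sqrt_div' _ (by positivity),
      Real.sqrt_sq hα.le]
    congr 1
    field_simp
  have hexp : Real.exp (-Real.pi * (α * y * m ^ 2 + y / α * k ^ 2)) =
      Real.exp (-Real.pi * (α * y * m ^ 2)) * Real.exp (-Real.pi / (α / y) * (k : ℝ) ^ 2) := by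
    rw [← Real.exp_add]
    congr 1
    field_simp
    ring
  have hc : Real.cos (2 * Real.pi * m * k * x) = Real.cos (2 * Real.pi * k * (m * x)) := by
    congr 1
    ring
  rw [fourierCoeffM, hexp, hq, hc]
  have hpi := Real.pi_pos
  field_simp
  ring

theorem latticeM_eq_tsum (α : ℝ) (z : ℍ) :
    latticeM α z = ∑' p : ℤ × ℤ, ((p.1 * z.re + p.2) ^ 2 + (p.1 * z.im) ^ 2) / z.im *
      Real.exp (-Real.pi * α * (((p.1 * z.re + p.2) ^ 2 + (p.1 * z.im) ^ 2) / z.im)) := by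
  simp only [latticeM, sq_norm_mul_add]

/-- The Fourier expansion of the lattice sum. -/
theorem sq_mul_latticeM {α : ℝ} (hα : 0 < α) (z : ℍ) :
    α ^ 2 * latticeM α z = √(α * z.im) * ∑' p : ℤ × ℤ,
      fourierCoeffM (α * z.im) (z.im / α) p.1 p.2 * Real.cos (2 * Real.pi * p.1 * p.2 * z.re) := by
  have hy := z.im_pos
  have hs := summable_latticeM hα z
  simp only [sq_norm_mul_add] at hs
  rw [latticeM_eq_tsum, hs.tsum_prod, (summable_fourierCoeffM_mul_cos (X := α * z.im)
    (Z := z.im / α) (by positivity) (by positivity) z.re).tsum_prod, ← tsum_mul_left,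
    ← tsum_mul_left]
  exact tsum_congr fun m => tsum_row α z.re z.im hα hy m

/-! ### Modular invariance, coercivity and existence of minimizers -/

-- For `g = (a b; c d)`, `m·gz + n = ((ma + nc)z + (mb + nd))/(cz + d)` and `Im gz = Im z/|cz +
-- d|²`. The factor `cz + d` cancels, and `(m, n)` is merely multiplied by `g`, a bijection of `ℤ²`.
open scoped MatrixGroups Modular in
theorem latticeM_smul (α : ℝ) (g : SL(2, ℤ)) (z : ℍ) : latticeM α (g • z) = latticeM α z := by
  have hdet : g 0 0 * g 1 1 - g 0 1 * g 1 0 = 1 := by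
    rw [← Matrix.det_fin_two]
    exact g.2
  let e : ℤ × ℤ ≃ ℤ × ℤ :=
    { toFun := fun p => (p.1 * g 0 0 + p.2 * g 1 0, p.1 * g 0 1 + p.2 * g 1 1)
      invFun := fun p => (p.1 * g 1 1 - p.2 * g 1 0, -p.1 * g 0 1 + p.2 * g 0 0)
      left_inv := fun p => by
        ext
        · linear_combination p.1 * hdet
        · linear_combination p.2 * hdet
      right_inv := fun p => by
        ext
        · linear_combination p.1 * hdet
        · linear_combination p.2 * hdet }
  have key : ∀ p : ℤ × ℤ, ‖(p.1 : ℂ) * ((g • z : ℍ) : ℂ) + (p.2 : ℂ)‖ ^ 2 / (g • z).im =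
      ‖((e p).1 : ℂ) * (z : ℂ) + ((e p).2 : ℂ)‖ ^ 2 / z.im := by
    intro p
    have hd : UpperHalfPlane.denom g z ≠ 0 := UpperHalfPlane.denom_ne_zero _ z
    have hden : UpperHalfPlane.denom g z = (g 1 0 : ℂ) * z + g 1 1 := by
      simp [UpperHalfPlane.denom]
    have him : (g • z).im = z.im / ‖(g 1 0 : ℂ) * z + g 1 1‖ ^ 2 := by
      rw [ModularGroup.im_smul_eq_div_normSq, Complex.normSq_eq_norm_sq, hden]
    rw [hden] at hd
    have hn : ‖(g 1 0 : ℂ) * z + g 1 1‖ ≠ 0 := norm_ne_zero_iff.2 hd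
    have hz := z.im_pos.ne'
    have hval : (p.1 : ℂ) * ((g • z : ℍ) : ℂ) + (p.2 : ℂ) =
        (((e p).1 : ℂ) * (z : ℂ) + ((e p).2 : ℂ)) / ((g 1 0 : ℂ) * z + g 1 1) := by
      rw [UpperHalfPlane.coe_specialLinearGroup_apply]
      simp only [e, Equiv.coe_fn_mk, algebraMap_int_eq, eq_intCast]
      push_cast
      rw [eq_div_iff hd, add_mul, mul_assoc, div_mul_cancel₀ _ hd]
      ring
    rw [hval, him, norm_div, div_pow]
    exact div_div_div_cancel_right₀ (pow_ne_zero 2 hn) _ _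
  simp only [latticeM, key]
  exact e.tsum_eq (fun p : ℤ × ℤ => ‖(p.1 : ℂ) * (z : ℂ) + (p.2 : ℂ)‖ ^ 2 / z.im *
    Real.exp (-Real.pi * α * (‖(p.1 : ℂ) * (z : ℂ) + (p.2 : ℂ)‖ ^ 2 / z.im)))

theorem latticeM_reflect (α : ℝ) (z w : ℍ) (hre : w.re = -z.re) (him : w.im = z.im) :
    latticeM α w = latticeM α z := by
  rw [latticeM_eq_tsum, latticeM_eq_tsum, hre, him]
  let e : ℤ × ℤ ≃ ℤ × ℤ := (Equiv.neg ℤ).prodCongr (Equiv.refl ℤ)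
  rw [← e.tsum_eq]
  refine tsum_congr fun p => ?_
  simp [e]

open scoped MatrixGroups Modular in
theorem exists_mem_half_domain (α : ℝ) (z : ℍ) :
    ∃ w : ℍ, 0 ≤ w.re ∧ w.re ≤ 1 / 2 ∧ 1 ≤ w.re ^ 2 + w.im ^ 2 ∧ latticeM α w = latticeM α z := by
  obtain ⟨g, hg⟩ := ModularGroup.exists_smul_mem_fd z
  obtain ⟨h1, h2⟩ := hg
  have hns : Complex.normSq (g • z : ℍ) = (g • z).re ^ 2 + (g • z).im ^ 2 := by
    rw [Complex.normSq_apply, UpperHalfPlane.coe_re, UpperHalfPlane.coe_im]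
    ring
  rw [hns] at h1
  rcases le_total 0 (g • z).re with h | h
  · exact ⟨g • z, h, (le_abs_self _).trans h2, h1, latticeM_smul α g z⟩
  · refine ⟨⟨⟨-(g • z).re, (g • z).im⟩, (g • z).im_pos⟩, ?_, ?_, ?_, ?_⟩
    · simpa using h
    · exact (neg_le_abs _).trans h2
    · change 1 ≤ (-(g • z).re) ^ 2 + (g • z).im ^ 2
      rwa [neg_sq]
    · rw [← latticeM_smul α g z]
      exact latticeM_reflect α _ _ rfl rfl

theorem latticeM_term_nonneg (α : ℝ) (z : ℍ) (p : ℤ × ℤ) :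
    0 ≤ ‖(p.1 : ℂ) * (z : ℂ) + (p.2 : ℂ)‖ ^ 2 / z.im *
      Real.exp (-Real.pi * α * (‖(p.1 : ℂ) * (z : ℂ) + (p.2 : ℂ)‖ ^ 2 / z.im)) := by
  have := z.im_pos
  positivity

theorem latticeM_nonneg (α : ℝ) (z : ℍ) : 0 ≤ latticeM α z :=
  tsum_nonneg fun p => latticeM_term_nonneg α z p

/-- Lower semicontinuity is enough to attain a minimum on a compact set, and a sum of nonnegative
continuous terms has it without any uniform convergence; values in `ENNReal` make this available. -/
theorem lowerSemicontinuous_ofReal_latticeM {α : ℝ} (hα : 0 < α) :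
    LowerSemicontinuous fun z : ℍ => ENNReal.ofReal (latticeM α z) := by
  have h : (fun z : ℍ => ENNReal.ofReal (latticeM α z)) = fun z : ℍ => ∑' p : ℤ × ℤ,
      ENNReal.ofReal (‖(p.1 : ℂ) * (z : ℂ) + (p.2 : ℂ)‖ ^ 2 / z.im *
      Real.exp (-Real.pi * α * (‖(p.1 : ℂ) * (z : ℂ) + (p.2 : ℂ)‖ ^ 2 / z.im))) := by
    funext z
    exact ENNReal.ofReal_tsum_of_nonneg (latticeM_term_nonneg α z) (summable_latticeM hα z)
  rw [h]
  refine lowerSemicontinuous_tsum fun p => Continuous.lowerSemicontinuous ?_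
  refine ENNReal.continuous_ofReal.comp ?_
  have hq : Continuous fun z : ℍ => ‖(p.1 : ℂ) * (z : ℂ) + (p.2 : ℂ)‖ ^ 2 / z.im := by
    refine Continuous.div ?_ UpperHalfPlane.continuous_im fun z => z.im_pos.ne'
    have := UpperHalfPlane.continuous_coe
    fun_prop
  exact hq.mul (Real.continuous_exp.comp (continuous_const.mul hq))

/-- `M(α, z)` tends to infinity with `Im z`. -/
theorem exists_lt_latticeM {α : ℝ} (hα : 0 < α) (C : ℝ) :
    ∃ Y : ℝ, 1 ≤ Y ∧ ∀ z : ℍ, Y < z.im → C < latticeM α z := by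
  -- Only the row `m = 0` is used. For `N = ⌈√y⌉` and `N < n ≤ 2N` one has `1 ≤ n²/y ≤ 16`, so each
  -- of these `N ≥ √y` vectors contributes at least `E`.
  set E := Real.exp (-Real.pi * α * 16) with hE
  have hE0 : 0 < E := Real.exp_pos _
  refine ⟨(C / E) ^ 2 + 1, by nlinarith [sq_nonneg (C / E)], fun z hz => ?_⟩
  have hy1 : 1 < z.im := by nlinarith [sq_nonneg (C / E)]
  have hs1 : 1 ≤ √z.im := Real.one_le_sqrt.2 hy1.le
  have hsq := Real.sq_sqrt z.im_pos.le
  set N := ⌈√z.im⌉₊ with hN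
  have hN1 : √z.im ≤ N := Nat.le_ceil _
  have hN2 : (N : ℝ) < √z.im + 1 := Nat.ceil_lt_add_one (Real.sqrt_nonneg _)
  have hC : C / E < √z.im := Real.lt_sqrt_of_sq_lt (by linarith)
  let ι : ℕ → ℤ × ℤ := fun n => (0, (n : ℤ))
  have hι : Function.Injective ι := fun a b hab => by simpa [ι] using hab
  have hsum : ∑ p ∈ (Finset.Ioc N (2 * N)).map ⟨ι, hι⟩,
      ‖(p.1 : ℂ) * (z : ℂ) + (p.2 : ℂ)‖ ^ 2 / z.im *
      Real.exp (-Real.pi * α * (‖(p.1 : ℂ) * (z : ℂ) + (p.2 : ℂ)‖ ^ 2 / z.im)) ≤ latticeM α z :=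
    (summable_latticeM hα z).sum_le_tsum _ fun p _ => latticeM_term_nonneg α z p
  rw [Finset.sum_map] at hsum
  have hlow : ∑ n ∈ Finset.Ioc N (2 * N), E ≤ latticeM α z := by
    refine le_trans (Finset.sum_le_sum fun n hn => ?_) hsum
    simp only [Function.Embedding.coeFn_mk, ι, Int.cast_zero, zero_mul, zero_add, Int.cast_natCast,
      Complex.norm_natCast]
    rw [Finset.mem_Ioc] at hn
    have h1 : (N : ℝ) < n := by exact_mod_cast hn.1
    have h2 : (n : ℝ) ≤ 2 * N := by exact_mod_cast hn.2
    have q1 : 1 ≤ (n : ℝ) ^ 2 / z.im := by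
      rw [le_div_iff₀ z.im_pos, one_mul, ← hsq]
      gcongr
      linarith
    have q2 : (n : ℝ) ^ 2 / z.im ≤ 16 := by
      rw [div_le_iff₀ z.im_pos, ← hsq]
      have : (n : ℝ) ≤ 4 * √z.im := by linarith
      nlinarith [Real.sqrt_nonneg z.im]
    have : E ≤ Real.exp (-Real.pi * α * ((n : ℝ) ^ 2 / z.im)) := by
      apply Real.exp_le_exp.2
      have := mul_le_mul_of_nonneg_left q2 (mul_pos Real.pi_pos hα).le
      linarith
    nlinarith
  rw [Finset.sum_const, Nat.card_Ioc, nsmul_eq_mul] at hlow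
  have : ((2 * N - N : ℕ) : ℝ) = N := by
    congr 1
    omega
  rw [this] at hlow
  rw [div_lt_iff₀ hE0] at hC
  nlinarith

/-- The floor `1/2` on the height costs nothing, since `y² ≥ 3/4` throughout the half domain. -/
theorem isCompact_box (Y : ℝ) :
    IsCompact {z : ℍ | 0 ≤ z.re ∧ z.re ≤ 1 / 2 ∧ 1 / 2 ≤ z.im ∧ z.im ≤ Y} := by
  rw [UpperHalfPlane.isOpenEmbedding_coe.isInducing.isCompact_iff]
  have h : (fun z : ℍ => (z : ℂ)) '' {z : ℍ | 0 ≤ z.re ∧ z.re ≤ 1 / 2 ∧ 1 / 2 ≤ z.im ∧ z.im ≤ Y} =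
      Set.Icc (0 : ℝ) (1 / 2) ×ℂ Set.Icc (1 / 2 : ℝ) Y := by
    ext w
    simp only [Set.mem_image, Set.mem_ofPred_eq, Complex.mem_reProdIm, Set.mem_Icc]
    constructor
    · rintro ⟨z, ⟨h1, h2, h3, h4⟩, rfl⟩
      exact ⟨⟨h1, h2⟩, h3, h4⟩
    · rintro ⟨⟨h1, h2⟩, h3, h4⟩
      exact ⟨⟨w, by linarith⟩, ⟨h1, h2, h3, h4⟩, rfl⟩
  rw [h]
  exact isCompact_Icc.reProdIm isCompact_Icc

/-- The lattice sum attains its minimum over the upper half-plane, at a point of the closed half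
fundamental domain. -/
theorem exists_forall_latticeM_le {α : ℝ} (hα : 0 < α) : ∃ w : ℍ, ∀ z : ℍ,
    latticeM α w ≤ latticeM α z := by
  obtain ⟨Y, hY1, hY⟩ := exists_lt_latticeM hα (latticeM α UpperHalfPlane.I)
  have hI : UpperHalfPlane.I ∈ {z : ℍ | 0 ≤ z.re ∧ z.re ≤ 1 / 2 ∧ 1 / 2 ≤ z.im ∧ z.im ≤ Y} := by
    refine ⟨?_, ?_, ?_, ?_⟩ <;> norm_num [UpperHalfPlane.I_re, UpperHalfPlane.I_im, hY1]
  obtain ⟨w, -, hw⟩ := LowerSemicontinuousOn.exists_isMinOn ⟨_, hI⟩ (isCompact_box Y)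
    ((lowerSemicontinuous_ofReal_latticeM hα).lowerSemicontinuousOn _)
  have hw' : ∀ z ∈ {z : ℍ | 0 ≤ z.re ∧ z.re ≤ 1 / 2 ∧ 1 / 2 ≤ z.im ∧ z.im ≤ Y},
      latticeM α w ≤ latticeM α z := fun z hz =>
    (ENNReal.ofReal_le_ofReal_iff (latticeM_nonneg α z)).1 (hw hz)
  refine ⟨w, fun z => ?_⟩
  obtain ⟨v, h1, h2, h3, hv⟩ := exists_mem_half_domain α z
  rw [← hv]
  rcases le_or_gt v.im Y with h | h
  · refine hw' v ⟨h1, h2, ?_, h⟩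
    nlinarith [v.im_pos]
  · exact (hw' _ hI).trans (hY v h).le

/-! ### Geometry of the half fundamental domain and of `Γ`. -/

theorem mem_closure_halfFundamentalDomain {z : ℍ} (h0 : 0 ≤ z.re) (h1 : z.re ≤ 1 / 2)
    (h2 : 1 ≤ z.re ^ 2 + z.im ^ 2) : z ∈ closure halfFundamentalDomain := by
  have hy := z.im_pos
  -- The point is pushed upwards while its real part is drawn towards `1/4`; all inequalities become
  -- strict, as `|f t|²` has initial slope `2(y + x(1/4 - x)) > 0`.
  let f : ℝ → ℂ := fun t => ⟨z.re + t * (1 / 4 - z.re), z.im + t⟩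
  have hf : Continuous f := by
    have : f = fun t : ℝ => ((z.re + t * (1 / 4 - z.re) : ℝ) : ℂ) + ((z.im + t : ℝ) : ℂ) *
        Complex.I := by
      funext t
      exact (Complex.mk_eq_add_mul_I _ _)
    rw [this]
    fun_prop
  have hf0 : f 0 = z := by
    apply Complex.ext <;> simp [f]
  have htend : Filter.Tendsto f (nhdsWithin 0 (Set.Ioi 0)) (nhds (z : ℂ)) := by
    rw [← hf0]
    exact hf.continuousAt.tendsto.mono_left nhdsWithin_le_nhds
  have hcl : (z : ℂ) ∈ closure ((fun w : ℍ => (w : ℂ)) '' halfFundamentalDomain) := by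
    refine mem_closure_of_tendsto htend ?_
    have hlt : ∀ᶠ t : ℝ in nhdsWithin 0 (Set.Ioi 0), t < 1 :=
      nhdsWithin_le_nhds (Iio_mem_nhds one_pos)
    filter_upwards [hlt, self_mem_nhdsWithin] with t ht1 ht0
    have ht0 : 0 < t := ht0
    refine ⟨⟨f t, by change 0 < z.im + t; linarith⟩, ⟨?_, ?_, ?_⟩, rfl⟩
    · change 1 < ‖f t‖
      have : ‖f t‖ ^ 2 = (z.re + t * (1 / 4 - z.re)) ^ 2 + (z.im + t) ^ 2 := by
        rw [← Complex.normSq_eq_norm_sq, Complex.normSq_apply]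
        simp only [f]
        ring
      have h3 : 1 < ‖f t‖ ^ 2 := by
        rw [this]
        have hy2 : 1 / 2 < z.im := by nlinarith
        have : 0 < z.im + z.re * (1 / 4 - z.re) := by nlinarith
        nlinarith [sq_nonneg (t * (1 / 4 - z.re)), mul_pos ht0 this, sq_nonneg t]
      nlinarith [norm_nonneg (f t)]
    · change 0 < z.re + t * (1 / 4 - z.re)
      nlinarith
    · change z.re + t * (1 / 4 - z.re) < 1 / 2
      nlinarith
  rw [UpperHalfPlane.isOpenEmbedding_coe.isInducing.closure_eq_preimage_closure_image]
  exact hcl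

theorem gamma_subset_closure : gammaA ∪ gammaB ⊆ closure halfFundamentalDomain := by
  rintro z (⟨y, hy, hz⟩ | ⟨t, ⟨ht1, ht2⟩, hz⟩)
  · have hre : z.re = 0 := by
      rw [← UpperHalfPlane.coe_re, hz]
      simp
    have him : z.im = y := by
      rw [← UpperHalfPlane.coe_im, hz]
      simp
    apply mem_closure_halfFundamentalDomain <;> rw [hre] <;> try rw [him]
    · norm_num
    · nlinarith
  · rw [mul_comm] at hz
    have hre : z.re = Real.cos t := by
      rw [← UpperHalfPlane.coe_re, hz, Complex.exp_ofReal_mul_I_re]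
    have him : z.im = Real.sin t := by
      rw [← UpperHalfPlane.coe_im, hz, Complex.exp_ofReal_mul_I_im]
    have hpi := Real.pi_pos
    apply mem_closure_halfFundamentalDomain
    · rw [hre]
      exact Real.cos_nonneg_of_mem_Icc ⟨by linarith, ht2⟩
    · rw [hre, ← Real.cos_pi_div_three]
      exact Real.cos_le_cos_of_nonneg_of_le_pi (by positivity) (by linarith) ht1
    · rw [hre, him, Real.cos_sq_add_sin_sq]

theorem mem_gammaA {z : ℍ} (h0 : z.re = 0) (h1 : 1 ≤ z.im) : z ∈ gammaA := by
  refine ⟨z.im, h1, ?_⟩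
  apply Complex.ext <;> simp [h0]

theorem mem_gammaB {z : ℍ} (h0 : 0 ≤ z.re) (h1 : z.re ≤ 1 / 2) (h2 : z.re ^ 2 + z.im ^ 2 = 1) :
    z ∈ gammaB := by
  have hs : Real.sin (Real.arccos z.re) = z.im := by
    rw [Real.sin_arccos, ← Real.sqrt_sq z.im_pos.le]
    congr 1
    linarith
  have hc : Real.cos (Real.arccos z.re) = z.re := Real.cos_arccos (by linarith) (by linarith)
  refine ⟨Real.arccos z.re, ⟨?_, Real.arccos_le_pi_div_two.2 h0⟩, ?_⟩
  · have hpi := Real.pi_pos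
    rw [← Real.arccos_cos (x := Real.pi / 3) (by positivity) (by linarith), Real.cos_pi_div_three]
    exact Real.arccos_le_arccos h1
  · rw [mul_comm]
    apply Complex.ext
    · rw [Complex.exp_ofReal_mul_I_re, hc, UpperHalfPlane.coe_re]
    · rw [Complex.exp_ofReal_mul_I_im, hs, UpperHalfPlane.coe_im]

/-- If every point of the closed half fundamental domain is dominated by a point of `Γ`, then the
three minima exist and agree. -/
theorem exists_isLeast_of_dominated {α : ℝ} (hα : 0 < α)
    (H : ∀ z : ℍ, 0 ≤ z.re → z.re ≤ 1 / 2 → 1 ≤ z.re ^ 2 + z.im ^ 2 →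
      ∃ w ∈ gammaA ∪ gammaB, latticeM α w ≤ latticeM α z) :
    ∃ μ : ℝ,
      IsLeast (Set.range (latticeM α)) μ ∧
      IsLeast (latticeM α '' closure halfFundamentalDomain) μ ∧
      IsLeast (latticeM α '' (gammaA ∪ gammaB)) μ := by
  obtain ⟨w, hw⟩ := exists_forall_latticeM_le hα
  obtain ⟨v, h1, h2, h3, hv⟩ := exists_mem_half_domain α w
  obtain ⟨u, hu, huv⟩ := H v h1 h2 h3
  have hmin : ∀ z, latticeM α u ≤ latticeM α z := fun z => huv.trans (hv.le.trans (hw z))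
  refine ⟨latticeM α u, ⟨⟨u, rfl⟩, ?_⟩, ⟨⟨u, gamma_subset_closure hu, rfl⟩, ?_⟩,
    ⟨⟨u, hu, rfl⟩, ?_⟩⟩
  · rintro _ ⟨z, rfl⟩
    exact hmin z
  · rintro _ ⟨z, -, rfl⟩
    exact hmin z
  · rintro _ ⟨z, -, rfl⟩
    exact hmin z

/-! ### Bounds for one-dimensional Gaussian sums -/

theorem tsum_int_even (f : ℤ → ℝ) (hf : ∀ n, f (-n) = f n) (hs : Summable f) :
    ∑' n : ℤ, f n = f 0 + 2 * ∑' j : ℕ, f ((j : ℤ) + 1) := by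
  rw [tsum_of_nat_of_neg_add_one (f := f)
    (hs.comp_injective Nat.cast_injective)
    (hs.comp_injective (i := fun n : ℕ => -((n : ℤ) + 1)) fun a b h => by simpa using h)]
  have h1 : Summable fun n : ℕ => f n := hs.comp_injective Nat.cast_injective
  rw [h1.tsum_eq_zero_add]
  simp only [hf]
  push_cast
  ring

/-- Since `j(j - 1) ≥ 0` for natural `j`, `(j + 1)² ≥ 1 + 3j`; Gaussian tails thus become geometric.
-/
theorem exp_neg_mul_sq_succ_le {c : ℝ} (hc : 0 < c) (j : ℕ) :
    Real.exp (-c * ((j : ℝ) + 1) ^ 2) ≤ Real.exp (-c) * (Real.exp (-c) ^ 3) ^ j := by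
  rw [← pow_mul, ← Real.exp_nat_mul, ← Real.exp_add]
  apply Real.exp_le_exp.2
  push_cast
  have h : (0 : ℝ) ≤ j * (j - 1) := by
    rcases j with _ | j
    · simp
    · push_cast
      have : (0 : ℝ) ≤ j := j.cast_nonneg
      nlinarith
  nlinarith

theorem sq_succ_le_four_pow (j : ℕ) : ((j : ℝ) + 1) ^ 2 ≤ 4 ^ j := by
  have h : (j + 1 : ℝ) ≤ 2 ^ j := by exact_mod_cast Nat.lt_two_pow_self (n := j)
  calc ((j : ℝ) + 1) ^ 2 ≤ (2 ^ j) ^ 2 := by gcongr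
    _ = 4 ^ j := by rw [← pow_mul, mul_comm, pow_mul]; norm_num

theorem tsum_le_geometric {f : ℕ → ℝ} {A r : ℝ} (hf : ∀ j, 0 ≤ f j) (hr0 : 0 ≤ r) (hr : r < 1)
    (h : ∀ j, f j ≤ A * r ^ j) : Summable f ∧ ∑' j, f j ≤ A / (1 - r) := by
  have hg : HasSum (fun j => A * r ^ j) (A / (1 - r)) := by
    simpa [div_eq_mul_inv] using (hasSum_geometric_of_lt_one hr0 hr).mul_left A
  have hs := Summable.of_nonneg_of_le hf h hg.summable
  exact ⟨hs, (hs.tsum_le_tsum h hg.summable).trans hg.tsum_eq.le⟩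

theorem tsum_gaussian_le {c q : ℝ} (hc : 0 < c) (hq : Real.exp (-c) ≤ q) (hq1 : 4 * q ^ 3 < 1) :
    Summable (fun n : ℤ => Real.exp (-c * (n : ℝ) ^ 2)) ∧
      ∑' n : ℤ, Real.exp (-c * (n : ℝ) ^ 2) ≤ 1 + 2 * (q / (1 - q ^ 3)) := by
  have hpi := Real.pi_pos
  have hs : Summable fun n : ℤ => Real.exp (-c * (n : ℝ) ^ 2) := by
    refine (summable_pow_mul_gaussian (div_pos hc hpi) 0).congr fun n => ?_
    rw [pow_zero, one_mul]
    congr 1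
    field_simp
  have hq0 : 0 < q := (Real.exp_pos _).trans_le hq
  refine ⟨hs, ?_⟩
  rw [tsum_int_even _ (fun n => by push_cast; rw [neg_sq]) hs]
  have h := (tsum_le_geometric (f := fun j : ℕ => Real.exp (-c * (((j : ℤ) + 1 : ℤ) : ℝ) ^ 2))
    (A := q) (r := q ^ 3) (fun j => (Real.exp_pos _).le) (by positivity) (by nlinarith [pow_pos hq0 3])
    fun j => by
      push_cast
      refine (exp_neg_mul_sq_succ_le hc j).trans ?_
      gcongr).2
  simp only [Int.cast_zero]
  norm_num at h ⊢
  exact h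

theorem tsum_sq_gaussian_le {c q : ℝ} (hc : 0 < c) (hq : Real.exp (-c) ≤ q) (hq1 : 4 * q ^ 3 < 1) :
    Summable (fun n : ℤ => (n : ℝ) ^ 2 * Real.exp (-c * (n : ℝ) ^ 2)) ∧
      ∑' n : ℤ, (n : ℝ) ^ 2 * Real.exp (-c * (n : ℝ) ^ 2) ≤ 2 * (q / (1 - 4 * q ^ 3)) := by
  have hpi := Real.pi_pos
  have hs : Summable fun n : ℤ => (n : ℝ) ^ 2 * Real.exp (-c * (n : ℝ) ^ 2) := by
    refine (summable_pow_mul_gaussian (div_pos hc hpi) 2).congr fun n => ?_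
    rw [sq_abs]
    congr 2
    field_simp
  have hq0 : 0 < q := (Real.exp_pos _).trans_le hq
  refine ⟨hs, ?_⟩
  rw [tsum_int_even _ (fun n => by push_cast; rw [neg_sq]) hs]
  have h := (tsum_le_geometric (f := fun j : ℕ => (((j : ℤ) + 1 : ℤ) : ℝ) ^ 2 *
      Real.exp (-c * (((j : ℤ) + 1 : ℤ) : ℝ) ^ 2))
    (A := q) (r := 4 * q ^ 3) (fun j => by positivity) (by positivity) hq1
    fun j => by
      push_cast
      calc ((j : ℝ) + 1) ^ 2 * Real.exp (-c * ((j : ℝ) + 1) ^ 2)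
          ≤ 4 ^ j * (q * (q ^ 3) ^ j) := by
            refine mul_le_mul (sq_succ_le_four_pow j) ((exp_neg_mul_sq_succ_le hc j).trans ?_)
              (Real.exp_pos _).le (by positivity)
            gcongr
        _ = q * (4 * q ^ 3) ^ j := by rw [mul_pow]; ring).2
  simp only [Int.cast_zero]
  norm_num at h ⊢
  exact h

/-! ### The square lattice -/

/-- For the square lattice the sum factors as `2 (∑ n² exp(-παn²)) (∑ exp(-παn²))`. -/
theorem latticeM_I_le {α q : ℝ} (hα : 0 < α) (hq : Real.exp (-(Real.pi * α)) ≤ q)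
    (hq1 : 4 * q ^ 3 < 1) :
    latticeM α UpperHalfPlane.I ≤
      2 * ((2 * (q / (1 - 4 * q ^ 3))) * (1 + 2 * (q / (1 - q ^ 3)))) := by
  have hc : 0 < Real.pi * α := mul_pos Real.pi_pos hα
  obtain ⟨hs0, h0⟩ := tsum_gaussian_le hc hq hq1
  obtain ⟨hs2, h2⟩ := tsum_sq_gaussian_le hc hq hq1
  set G : ℤ → ℝ := fun n => Real.exp (-(Real.pi * α) * (n : ℝ) ^ 2) with hG
  set H : ℤ → ℝ := fun n => (n : ℝ) ^ 2 * Real.exp (-(Real.pi * α) * (n : ℝ) ^ 2) with hH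
  have nG : 0 ≤ G := fun n => (Real.exp_pos _).le
  have nH : 0 ≤ H := fun n => by positivity
  have sGH := hs0.mul_of_nonneg hs2 nG nH
  have sHG := hs2.mul_of_nonneg hs0 nH nG
  have e : latticeM α UpperHalfPlane.I = (∑' n, H n) * (∑' n, G n) + (∑' n, G n) * ∑' n, H n := by
    rw [hs2.tsum_mul_tsum hs0 sHG, hs0.tsum_mul_tsum hs2 sGH, ← sHG.tsum_add sGH, latticeM_eq_tsum]
    refine tsum_congr fun p => ?_
    simp only [UpperHalfPlane.I_re, UpperHalfPlane.I_im, mul_zero, zero_add, mul_one, div_one]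
    have : Real.exp (-Real.pi * α * ((p.2 : ℝ) ^ 2 + (p.1 : ℝ) ^ 2)) = G p.1 * G p.2 := by
      rw [hG, ← Real.exp_add]
      congr 1
      ring
    rw [this]
    simp only [hG, hH]
    ring
  have pG : 0 ≤ ∑' n, G n := tsum_nonneg nG
  have pH : 0 ≤ ∑' n, H n := tsum_nonneg nH
  rw [e]
  have := mul_le_mul h2 h0 pG (pH.trans h2)
  linarith

/-! ### Lattices close to the hexagonal lattice -/

theorem sum_le_latticeM {α : ℝ} (hα : 0 < α) (z : ℍ) (s : Finset (ℤ × ℤ)) :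
    ∑ p ∈ s, ((p.1 * z.re + p.2) ^ 2 + (p.1 * z.im) ^ 2) / z.im *
      Real.exp (-Real.pi * α * (((p.1 * z.re + p.2) ^ 2 + (p.1 * z.im) ^ 2) / z.im)) ≤
      latticeM α z := by
  have hs := summable_latticeM hα z
  simp only [sq_norm_mul_add] at hs
  rw [latticeM_eq_tsum]
  refine hs.sum_le_tsum _ fun p _ => ?_
  have := z.im_pos
  positivity

/-- The contribution of the twelve shortest vectors of a lattice close to the hexagonal one. -/
theorem shells_le_latticeM {α : ℝ} (hα : 0 < α) (z : ℍ) (φ : ℝ → ℝ)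
    (hφ : ∀ q, φ q = q * Real.exp (-(Real.pi * α) * q)) :
    2 * (φ (1 / z.im) + φ ((z.re ^ 2 + z.im ^ 2) / z.im) +
        φ (((1 - z.re) ^ 2 + z.im ^ 2) / z.im)) +
      2 * (φ (((1 + z.re) ^ 2 + z.im ^ 2) / z.im) + φ (((2 - z.re) ^ 2 + z.im ^ 2) / z.im) +
        φ (((1 - 2 * z.re) ^ 2 + 4 * z.im ^ 2) / z.im)) ≤ latticeM α z := by
  have h := sum_le_latticeM hα z {(0, 1), (0, -1), (1, 0), (-1, 0), (1, -1), (-1, 1), (1, 1),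
    (-1, -1), (1, -2), (-1, 2), (2, -1), (-2, 1)}
  refine le_trans (le_of_eq ?_) h
  simp only [hφ]
  iterate 11 rw [Finset.sum_insert (by decide)]
  rw [Finset.sum_singleton]
  push_cast
  ring_nf

/-- Cubic Taylor lower bound for the exponential. -/
theorem cubic_le_exp_neg {t : ℝ} (ht : |t| ≤ 1) :
    1 - t + t ^ 2 / 2 - t ^ 3 / 6 ≤ Real.exp (-t) := by
  have h := Real.exp_bound (x := -t) (by rwa [abs_neg]) (n := 5) (by norm_num)
  have h2 := neg_le_of_abs_le h
  simp only [Finset.sum_range_succ, Finset.sum_range_zero, Nat.factorial] at h2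
  norm_num at h2
  -- The term `t⁴/24` absorbs the remainder `|t|⁵/100`, whatever the sign of `t`.
  have h5 : |t| ^ 5 ≤ t ^ 4 := by
    have : t ^ 4 = |t| ^ 4 := by rw [← abs_pow, abs_of_nonneg (by positivity)]
    rw [this]
    exact pow_le_pow_of_le_one (abs_nonneg t) ht (by norm_num)
  have h4 : (-t) ^ 3 = - t ^ 3 := by ring
  nlinarith [sq_nonneg (t ^ 2)]

/-- Second-order expansion at the hexagonal squared length `q₀`. The cubic and quartic terms amount
to `-d²(c²(cq₀ - 3)d/6 + c³d²/6)`; the bracket is at most `0.052` for `|d| ≤ 0.071`, which is what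
the quadratic coefficient gives up. -/
theorem first_shell_term {c q₀ d : ℝ} (hc : 2.868 ≤ c) (hc' : c ≤ 2.8764) (hq : 1.1547 ≤ q₀)
    (hq' : q₀ ≤ 1.15471) (hd : |d| ≤ 0.071) :
    Real.exp (-c * q₀) * (q₀ + (1 - c * q₀) * d + (c * (c * q₀ / 2 - 1) - 0.052) * d ^ 2) ≤
      (q₀ + d) * Real.exp (-c * (q₀ + d)) := by
  have e : Real.exp (-c * (q₀ + d)) = Real.exp (-c * q₀) * Real.exp (-(c * d)) := by
    rw [← Real.exp_add]
    congr 1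
    ring
  obtain ⟨d1, d2⟩ := abs_le.1 hd
  have hcd : |c * d| ≤ 1 := by
    rw [abs_mul, abs_of_nonneg (by linarith)]
    nlinarith [abs_nonneg d]
  have h := mul_le_mul_of_nonneg_left (cubic_le_exp_neg hcd) (by linarith : 0 ≤ q₀ + d)
  rw [e]
  have h2 : q₀ + (1 - c * q₀) * d + (c * (c * q₀ / 2 - 1) - 0.052) * d ^ 2 ≤
      (q₀ + d) * (1 - c * d + (c * d) ^ 2 / 2 - (c * d) ^ 3 / 6) := by
    have hs1 : c * q₀ ≤ 3.32142 := by nlinarith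
    have hs2 : 3 ≤ c * q₀ := by nlinarith
    have hc2 : c ^ 2 ≤ 8.27368 := by nlinarith
    have hc3 : c ^ 3 ≤ 23.7985 := by
      have : c ^ 3 = c * c ^ 2 := by ring
      rw [this]
      nlinarith [sq_nonneg c]
    have hk : c ^ 2 * (c * q₀ - 3) ≤ 2.66 := by nlinarith [sq_nonneg c]
    have hk0 : 0 ≤ c ^ 2 * (c * q₀ - 3) := mul_nonneg (sq_nonneg c) (by linarith)
    have hd2 : d ^ 2 ≤ 0.071 ^ 2 := by nlinarith
    have h1 : c ^ 2 * (c * q₀ - 3) * d ≤ 2.66 * 0.071 := by nlinarith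
    have h3 : c ^ 3 * d ^ 2 ≤ 23.7985 * 0.071 ^ 2 := by nlinarith [sq_nonneg d]
    have h4 : 0 ≤ d ^ 2 * (0.052 - c ^ 2 * (c * q₀ - 3) * d / 6 - c ^ 3 * d ^ 2 / 6) := by
      apply mul_nonneg (sq_nonneg d)
      linarith
    linear_combination h4
  calc _ ≤ Real.exp (-c * q₀) * ((q₀ + d) * (1 - c * d + (c * d) ^ 2 / 2 - (c * d) ^ 3 / 6)) :=
        mul_le_mul_of_nonneg_left h2 (Real.exp_pos _).le
    _ ≤ Real.exp (-c * q₀) * ((q₀ + d) * Real.exp (-(c * d))) :=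
        mul_le_mul_of_nonneg_left h (Real.exp_pos _).le
    _ = _ := by ring

/-- By Heron's formula `hH` expresses covolume `1`: the triangle with squared sides `qᵢ` has area
`1/2`. With `σ = ∑ qᵢ` it gives `∑ qᵢ² = (σ² - 4)/2`, and `∑ qᵢ² ≥ σ²/3` then forces `σ² ≥ 12`. -/
theorem two_sqrt_three_le {q₁ q₂ q₃ : ℝ} (h₁ : 0 < q₁ + q₂ + q₃)
    (hH : 2 * (q₁ * q₂ + q₂ * q₃ + q₃ * q₁) - (q₁ ^ 2 + q₂ ^ 2 + q₃ ^ 2) = 4) :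
    2 * √3 ≤ q₁ + q₂ + q₃ := by
  have h3 := Real.sq_sqrt (show (0 : ℝ) ≤ 3 by norm_num)
  have : 12 ≤ (q₁ + q₂ + q₃) ^ 2 := by
    nlinarith [sq_nonneg (q₁ - q₂), sq_nonneg (q₂ - q₃), sq_nonneg (q₃ - q₁)]
  by_contra! hlt
  nlinarith [Real.sqrt_nonneg 3]

/-- The first shell of a unimodular lattice close to the hexagonal one; `q₁, q₂, q₃` are the squared
lengths of the three pairs of shortest vectors. -/
theorem first_shell_le {c q₁ q₂ q₃ : ℝ} (hc : 2.868 ≤ c) (hc' : c ≤ 2.8764)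
    (h1 : |q₁ - 2 / √3| ≤ 0.071) (h2 : |q₂ - 2 / √3| ≤ 0.071) (h3 : |q₃ - 2 / √3| ≤ 0.071)
    (hH : 2 * (q₁ * q₂ + q₂ * q₃ + q₃ * q₁) - (q₁ ^ 2 + q₂ ^ 2 + q₃ ^ 2) = 4) :
    Real.exp (-c * (2 / √3)) * (2 * √3 - 0.205 * (q₁ + q₂ + q₃ - 2 * √3)) ≤
      q₁ * Real.exp (-c * q₁) + q₂ * Real.exp (-c * q₂) + q₃ * Real.exp (-c * q₃) := by
  have hs3 := Real.sq_sqrt (show (0 : ℝ) ≤ 3 by norm_num)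
  have hs3' : 0 < √3 := by positivity
  have s1 : 1.73205 ≤ √3 := Real.le_sqrt_of_sq_le (by norm_num)
  have s2 : √3 ≤ 1.73206 := Real.sqrt_le_iff.2 ⟨by norm_num, by norm_num⟩
  set q₀ := 2 / √3 with hq0
  have hq0' : q₀ * √3 = 2 := by rw [hq0]; field_simp
  have hq03 : 3 * q₀ = 2 * √3 := by
    have : (3 * q₀) * √3 = (2 * √3) * √3 := by linear_combination 3 * hq0' - 2 * hs3
    exact mul_right_cancel₀ hs3'.ne' this
  have hq : 1.1547 ≤ q₀ := by linarith
  have hq' : q₀ ≤ 1.15471 := by linarith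
  have t1 := first_shell_term hc hc' hq hq' h1
  have t2 := first_shell_term hc hc' hq hq' h2
  have t3 := first_shell_term hc hc' hq hq' h3
  simp only [add_sub_cancel] at t1 t2 t3
  have hσ : 2 * √3 ≤ q₁ + q₂ + q₃ := two_sqrt_three_le
    (by linarith [(abs_le.1 h1).1, (abs_le.1 h2).1, (abs_le.1 h3).1]) hH
  set κ := c * (c * q₀ / 2 - 1) - 0.052 with hκ
  have hsl : 3.3116 ≤ c * q₀ := by nlinarith
  have hκ0 : 0 ≤ κ := by nlinarith
  -- The covolume constraint makes the quadratic deviation first order in `δ = q₁ + q₂ + q₃ - 2√3`: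
  -- it equals `q₀δ + δ²/2`. It therefore offsets most of the negative slope `1 - cq₀`, leaving a
  -- net slope of at least `-0.205`.
  have hsum : q₀ * (q₁ + q₂ + q₃ - 2 * √3) ≤
      (q₁ - q₀) ^ 2 + (q₂ - q₀) ^ 2 + (q₃ - q₀) ^ 2 := by
    have hh : (q₁ - q₀) ^ 2 + (q₂ - q₀) ^ 2 + (q₃ - q₀) ^ 2 - q₀ * (q₁ + q₂ + q₃ - 2 * √3) =
        (q₁ + q₂ + q₃ - 2 * √3) ^ 2 / 2 := by
      have h33 : q₀ = 2 * √3 / 3 := by linarith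
      rw [h33]
      linear_combination (-1 / 2) * hH + (2 / 3) * hs3
    linarith [sq_nonneg (q₁ + q₂ + q₃ - 2 * √3)]
  have hcoef : -0.205 ≤ 1 - c * q₀ + κ * q₀ := by
    have : 1 - c * q₀ + κ * q₀ = 1 - 2 * (c * q₀) + (c * q₀) ^ 2 / 2 - 0.052 * q₀ := by
      rw [hκ]
      ring
    rw [this]
    nlinarith
  have hmain : 2 * √3 - 0.205 * (q₁ + q₂ + q₃ - 2 * √3) ≤
      (q₀ + (1 - c * q₀) * (q₁ - q₀) + κ * (q₁ - q₀) ^ 2) +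
      (q₀ + (1 - c * q₀) * (q₂ - q₀) + κ * (q₂ - q₀) ^ 2) +
      (q₀ + (1 - c * q₀) * (q₃ - q₀) + κ * (q₃ - q₀) ^ 2) := by
    have a1 := mul_le_mul_of_nonneg_left hsum hκ0
    have a2 := mul_le_mul_of_nonneg_right hcoef (sub_nonneg.2 hσ)
    have a3 : (1 - c * q₀) * (q₁ + q₂ + q₃ - 3 * q₀) = (1 - c * q₀) * (q₁ + q₂ + q₃ - 2 * √3) := by
      rw [hq03]
    linarith
  have := mul_le_mul_of_nonneg_left hmain (Real.exp_pos (-c * q₀)).le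
  linarith

/-- The second shell of a unimodular lattice close to the hexagonal one. -/
theorem second_shell_le {c q₁ q₂ q₃ σ : ℝ} (hc : 0 < c) (hc' : c ≤ 2.8764)
    (h1 : 0 ≤ q₁) (h2 : 0 ≤ q₂) (h3 : 0 ≤ q₃) (hσ : q₁ + q₂ + q₃ = 3 * σ)
    (hσ1 : 2 * √3 ≤ σ) (hσ2 : σ ≤ 2 * √3 + 0.0063)
    (hH : 2 * (q₁ * q₂ + q₂ * q₃ + q₃ * q₁) - (q₁ ^ 2 + q₂ ^ 2 + q₃ ^ 2) = 36) :
    Real.exp (-c * (2 / √3)) ^ 3 * (6 * √3 - 0.36) ≤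
      q₁ * Real.exp (-c * q₁) + q₂ * Real.exp (-c * q₂) + q₃ * Real.exp (-c * q₃) := by
  have hs3 := Real.sq_sqrt (show (0 : ℝ) ≤ 3 by norm_num)
  have hs3' : 0 < √3 := by positivity
  have s1 : 1.73205 ≤ √3 := Real.le_sqrt_of_sq_le (by norm_num)
  have s2 : √3 ≤ 1.73206 := Real.sqrt_le_iff.2 ⟨by norm_num, by norm_num⟩
  -- The second-shell squared length `2√3` is three times the first, `2/√3`.
  have he : Real.exp (-c * (2 / √3)) ^ 3 = Real.exp (-c * (2 * √3)) := by
    rw [← Real.exp_nat_mul]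
    congr 1
    push_cast
    field_simp
    linear_combination hs3
  have key : ∀ q, 0 ≤ q → Real.exp (-c * (2 * √3)) * (q * (1 - c * (q - 2 * √3))) ≤
      q * Real.exp (-c * q) := by
    intro q hq
    have h : Real.exp (-c * q) = Real.exp (-c * (2 * √3)) * Real.exp (-(c * (q - 2 * √3))) := by
      rw [← Real.exp_add]
      congr 1
      ring
    have h' := Real.one_sub_le_exp_neg (c * (q - 2 * √3))
    rw [h]
    have := mul_le_mul_of_nonneg_left (mul_le_mul_of_nonneg_left h' hq)
      (Real.exp_pos (-c * (2 * √3))).le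
    linarith
  have k1 := key q₁ h1
  have k2 := key q₂ h2
  have k3 := key q₃ h3
  -- In `hH` the value `36` is Heron's expression for area `3/2`: second-shell vectors span a
  -- sublattice of index three. Together with the sum `3σ` it fixes the sum of squares.
  have hsq : q₁ ^ 2 + q₂ ^ 2 + q₃ ^ 2 = (9 * σ ^ 2 - 36) / 2 := by
    have : (q₁ + q₂ + q₃) ^ 2 = 9 * σ ^ 2 := by rw [hσ]; ring
    linarith
  have hpoly : 6 * √3 - 0.36 ≤ q₁ * (1 - c * (q₁ - 2 * √3)) + q₂ * (1 - c * (q₂ - 2 * √3)) +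
      q₃ * (1 - c * (q₃ - 2 * √3)) := by
    have e : q₁ * (1 - c * (q₁ - 2 * √3)) + q₂ * (1 - c * (q₂ - 2 * √3)) +
      q₃ * (1 - c * (q₃ - 2 * √3)) = 3 * σ - c * ((9 * σ ^ 2 - 36) / 2 - 6 * √3 * σ) := by
      rw [← hsq]
      linear_combination (1 + 2 * c * √3) * hσ
    rw [e]
    set ε := σ - 2 * √3 with hε
    have e2 : (9 * σ ^ 2 - 36) / 2 - 6 * √3 * σ = 12 * √3 * ε + 4.5 * ε ^ 2 := by
      rw [hε]
      linear_combination 6 * hs3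
    have hε0 : 0 ≤ ε := by linarith
    have hε1 : ε ≤ 0.0063 := by linarith
    rw [e2]
    have b1 : 12 * √3 * ε + 4.5 * ε ^ 2 ≤ 20.82 * ε := by
      have b3 := mul_le_mul_of_nonneg_right s2 hε0
      have b4 := mul_le_mul_of_nonneg_right hε1 hε0
      linarith
    have b2 : c * (12 * √3 * ε + 4.5 * ε ^ 2) ≤ 2.8764 * (20.82 * ε) :=
      mul_le_mul hc' b1 (by positivity) (by norm_num)
    linarith
  rw [he]
  have := mul_le_mul_of_nonneg_left hpoly (Real.exp_pos (-c * (2 * √3))).le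
  linarith

/-! ### Comparison with the square lattice near the hexagonal lattice -/

theorem exp_le_taylor {x : ℝ} (h0 : 0 ≤ x) (h1 : x ≤ 1) :
    Real.exp x ≤ 1 + x + x ^ 2 / 2 + x ^ 3 / 6 + x ^ 4 / 24 + x ^ 5 / 120 + x ^ 6 / 720 +
      x ^ 7 / 4410 := by
  have h := Real.exp_bound' h0 h1 (n := 7) (by norm_num)
  refine h.trans (le_of_eq ?_)
  simp only [Finset.sum_range_succ, Finset.sum_range_zero, Nat.factorial]
  norm_num
  ring

theorem taylor_le_exp {x : ℝ} (h0 : 0 ≤ x) :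
    1 + x + x ^ 2 / 2 + x ^ 3 / 6 + x ^ 4 / 24 + x ^ 5 / 120 + x ^ 6 / 720 ≤ Real.exp x := by
  have h := Real.sum_le_exp_of_nonneg h0 7
  refine (le_of_eq ?_).trans h
  simp only [Finset.sum_range_succ, Finset.sum_range_zero, Nat.factorial]
  norm_num

/-- `2.8764` bounds `0.9155730607 π` from above, and `3.32141` bounds `2.8764 · 2/√3`. -/
theorem exp_neg_hexagonal : 0.036101 ≤ Real.exp (-3.32141) := by
  have h1 := exp_le_taylor (x := 0.32141) (by norm_num) (by norm_num)
  have h2 := Real.exp_one_lt_d9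
  have h3 : Real.exp 3.32141 = Real.exp 1 ^ 3 * Real.exp 0.32141 := by
    rw [← Real.exp_nat_mul, ← Real.exp_add]
    norm_num
  have h4 : Real.exp 3.32141 ≤ 27.7 := by
    rw [h3]
    calc Real.exp 1 ^ 3 * Real.exp 0.32141 ≤ 2.7182818286 ^ 3 * 1.379072 := by
          gcongr
          refine h1.trans ?_
          norm_num
      _ ≤ 27.7 := by norm_num
  rw [Real.exp_neg]
  calc (0.036101 : ℝ) ≤ (27.7)⁻¹ := by norm_num
    _ ≤ _ := inv_anti₀ (Real.exp_pos _) h4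

theorem exp_neg_square : Real.exp (-2.8764) ≤ 0.0563375 := by
  have h1 := exp_le_taylor (x := 0.1236) (by norm_num) (by norm_num)
  have h2 := Real.exp_one_gt_d9
  have h3 : Real.exp (-2.8764) * Real.exp 1 ^ 3 = Real.exp 0.1236 := by
    rw [← Real.exp_nat_mul, ← Real.exp_add]
    norm_num
  have h4 : (2.7182818283 : ℝ) ^ 3 ≤ Real.exp 1 ^ 3 := by gcongr
  have h5 := mul_le_mul_of_nonneg_left h4 (Real.exp_pos (-2.8764)).le
  rw [h3] at h5
  norm_num at h1 h5 ⊢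
  linarith

/-- The numerical inequality between the twelve shortest vectors of the hexagonal lattice and the
square lattice. -/
theorem square_lt_hexagonal {c : ℝ} (hc : 2.868 ≤ c) (hc' : c ≤ 2.8764) :
    ∃ q : ℝ, Real.exp (-c) ≤ q ∧ 4 * q ^ 3 < 1 ∧
      2 * ((2 * (q / (1 - 4 * q ^ 3))) * (1 + 2 * (q / (1 - q ^ 3)))) ≤
      2 * (Real.exp (-c * (2 / √3)) * (2 * √3 - 0.0013)) +
        2 * (Real.exp (-c * (2 / √3)) ^ 3 * (6 * √3 - 0.36)) := by
  have hs3' : 0 < √3 := by positivity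
  have s1 : 1.73205 ≤ √3 := Real.le_sqrt_of_sq_le (by norm_num)
  have s2 : √3 ≤ 1.732051 := Real.sqrt_le_iff.2 ⟨by norm_num, by norm_num⟩
  have hq0 : 2 / √3 ≤ 1.15471 := by
    rw [div_le_iff₀ hs3']
    linarith
  have hq0' : 1.1547 ≤ 2 / √3 := by
    rw [le_div_iff₀ hs3']
    linarith
  -- The tight case is `c = 2.8764`, where the bounds below leave a margin of about `3·10⁻⁵`. As `c`
  -- decreases both sides grow, the hexagonal one faster, so first-order control in `η` suffices.
  obtain ⟨η, hη⟩ : ∃ η, η = 2.8764 - c := ⟨_, rfl⟩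
  have hη0 : 0 ≤ η := by linarith
  have hη1 : η ≤ 0.0084 := by linarith
  have hE : 0.036101 * (1 + 1.1547 * η) ≤ Real.exp (-c * (2 / √3)) := by
    have h1 : Real.exp (-3.32141) * Real.exp (1.1547 * η) ≤ Real.exp (-c * (2 / √3)) := by
      rw [← Real.exp_add]
      apply Real.exp_le_exp.2
      have : c = 2.8764 - η := by linarith
      rw [this]
      nlinarith
    refine le_trans ?_ h1
    have h2 := Real.add_one_le_exp (1.1547 * η)
    exact mul_le_mul exp_neg_hexagonal (by linarith) (by positivity) (Real.exp_pos _).le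
  have he : Real.exp (-c) ≤ 0.0563375 * (1 + η + η ^ 2) := by
    have h1 : Real.exp (-c) = Real.exp (-2.8764) * Real.exp η := by
      rw [← Real.exp_add]
      congr 1
      linarith
    rw [h1]
    refine mul_le_mul exp_neg_square ?_ (Real.exp_pos _).le (by norm_num)
    have h2 := Real.abs_exp_sub_one_sub_id_le (x := η) (by rw [abs_of_nonneg hη0]; linarith)
    linarith [(abs_le.1 h2).2]
  set E := Real.exp (-c * (2 / √3)) with hEdef
  set q := 0.0563375 * (1 + η + η ^ 2) with hq
  have hq1 : q ≤ 0.0569 := by nlinarith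
  have hqp : 0 < q := by positivity
  have hq3 : q ^ 3 ≤ 0.000185 := by
    calc q ^ 3 ≤ 0.0569 ^ 3 := by gcongr
      _ ≤ _ := by norm_num
  have hq4 : q ^ 4 ≤ 0.0000105 := by
    calc q ^ 4 ≤ 0.0569 ^ 4 := by gcongr
      _ ≤ _ := by norm_num
  refine ⟨q, he, by linarith, ?_⟩
  have b1 : q / (1 - 4 * q ^ 3) ≤ q + 4.01 * q ^ 4 := by
    rw [div_le_iff₀ (by linarith)]
    have : 0 ≤ q ^ 4 * (0.01 - 16.04 * q ^ 3) := by
      apply mul_nonneg (by positivity)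
      linarith
    linear_combination this
  have b2 : q / (1 - q ^ 3) ≤ q + 1.01 * q ^ 4 := by
    rw [div_le_iff₀ (by linarith)]
    have : 0 ≤ q ^ 4 * (0.01 - 1.01 * q ^ 3) := by
      apply mul_nonneg (by positivity)
      linarith
    linear_combination this
  have b1' : q / (1 - 4 * q ^ 3) ≤ q + 0.0000422 := by linarith
  have b2' : q / (1 - q ^ 3) ≤ q + 0.0000107 := by linarith
  have b3 : 0 ≤ q / (1 - q ^ 3) := div_nonneg hqp.le (by linarith)
  have hU : 2 * ((2 * (q / (1 - 4 * q ^ 3))) * (1 + 2 * (q / (1 - q ^ 3)))) ≤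
      4 * q + 8 * q ^ 2 + 0.000195 := by
    calc _ ≤ 2 * ((2 * (q + 0.0000422)) * (1 + 2 * (q + 0.0000107))) := by gcongr
      _ ≤ _ := by nlinarith
  refine hU.trans ?_
  have hE1 : 0.036101 ≤ E := by nlinarith
  have hE3 : 0.00004704 ≤ E ^ 3 := by
    calc (0.00004704 : ℝ) ≤ 0.036101 ^ 3 := by norm_num
      _ ≤ _ := by gcongr
  have l1 : 0.036101 * (1 + 1.1547 * η) * 3.4628 ≤ E * (2 * √3 - 0.0013) :=
    mul_le_mul hE (by linarith) (by norm_num) (Real.exp_pos _).le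
  have l2 : 0.00004704 * 10.032 ≤ E ^ 3 * (6 * √3 - 0.36) :=
    mul_le_mul hE3 (by linarith) (by norm_num) (by positivity)
  have hη2 : η ^ 2 ≤ 0.0084 * η := by nlinarith
  have hq2 : q ≤ 0.0563375 * (1 + 1.0084 * η) := by
    rw [hq]
    linarith
  have hqq : q ^ 2 ≤ 0.0563375 ^ 2 * (1 + 2.03 * η) := by
    have hpow : (1 + 1.0084 * η) ^ 2 ≤ 1 + 2.03 * η := by
      have : (1 + 1.0084 * η) ^ 2 = 1 + 2.0168 * η + 1.0084 ^ 2 * η ^ 2 := by ring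
      rw [this]
      linarith
    calc q ^ 2 ≤ (0.0563375 * (1 + 1.0084 * η)) ^ 2 := by gcongr
      _ = 0.0563375 ^ 2 * (1 + 1.0084 * η) ^ 2 := by ring
      _ ≤ _ := by gcongr
  linarith

/-- Here `y/α - αy = y(1 - α²)/α` and `y ≥ √3/2`, so a small value forces `α` up. The upper bound on
`α` then limits `y`, and `x² ≥ 1 - y²` brings `x` near `1/2`. -/
theorem near_hexagonal_bounds {α x y : ℝ} (hα : 0 < α) (hα₁ : α < 0.9155730607) (hy : 0 < y)
    (hx0 : 0 ≤ x) (hx : x ≤ 1 / 2) (hxy : 1 ≤ x ^ 2 + y ^ 2)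
    (hω : y / α - α * y < 1 / (2 * Real.pi) - 0.0018) :
    0.913 ≤ α ∧ 0.866 ≤ y ∧ y ≤ 0.8909 ∧ 0.4541 ≤ x := by
  have hp : 1 / (2 * Real.pi) ≤ 0.159156 := by
    rw [div_le_iff₀ (by positivity)]
    linarith [Real.pi_gt_d6]
  have hy1 : 0.866 ≤ y := by nlinarith
  have hw : y * (1 - α ^ 2) < 0.157356 * α := by
    have : y / α - α * y = y * (1 - α ^ 2) / α := by field_simp
    rw [this] at hω
    have h2 := hω.trans_le (sub_le_sub_right hp 0.0018)
    rw [div_lt_iff₀ hα] at h2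
    linarith
  have ha : 0.913 ≤ α := by
    by_contra! h
    have h1 : 0.16643 ≤ 1 - α ^ 2 := by nlinarith
    have h2 : 0.866 * 0.16643 ≤ y * (1 - α ^ 2) := mul_le_mul hy1 h1 (by norm_num) hy.le
    linarith
  have hy2 : y ≤ 0.8909 := by
    have h1 : 0.161725 ≤ 1 - α ^ 2 := by nlinarith
    have h2 : y * 0.161725 ≤ 0.157356 * 0.9155730607 := by nlinarith
    linarith
  exact ⟨ha, hy1, hy2, by nlinarith⟩

theorem near_hexagonal_first_shell {x y : ℝ} (hx : x ≤ 1 / 2) (hxy : 1 ≤ x ^ 2 + y ^ 2)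
    (hy1 : 0.866 ≤ y) (hy2 : y ≤ 0.8909) (hx1 : 0.4541 ≤ x) :
    |1 / y - 2 / √3| ≤ 0.071 ∧ |(x ^ 2 + y ^ 2) / y - 2 / √3| ≤ 0.071 ∧
      |((1 - x) ^ 2 + y ^ 2) / y - 2 / √3| ≤ 0.071 := by
  have hy : 0 < y := by linarith
  have hs3' : 0 < √3 := by positivity
  have s1 : 1.73205 ≤ √3 := Real.le_sqrt_of_sq_le (by norm_num)
  have s2 : √3 ≤ 1.732051 := Real.sqrt_le_iff.2 ⟨by norm_num, by norm_num⟩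
  have hq0 : 2 / √3 ≤ 1.15471 := by
    rw [div_le_iff₀ hs3']
    linarith
  have hq0' : 1.1547 ≤ 2 / √3 := by
    rw [le_div_iff₀ hs3']
    linarith
  -- This keeps `y²` below its chord on `[0.866, 0.8909]`, making the bounds below linear in `y`.
  have hprod : 0 ≤ (y - 0.866) * (0.8909 - y) := mul_nonneg (by linarith) (by linarith)
  have hx2 : x ^ 2 ≤ 0.25 := by nlinarith
  have hx3 : (1 - x) ^ 2 ≤ 0.5459 ^ 2 := by
    have : 0 ≤ 1 - x := by linarith
    gcongr
    linarith
  have hx4 : x ^ 2 ≤ (1 - x) ^ 2 := by nlinarith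
  have u1 : 1 / y ≤ 1.2 := by rw [div_le_iff₀ hy]; linarith
  have l1 : 1.1 ≤ 1 / y := by rw [le_div_iff₀ hy]; linarith
  have u2 : (x ^ 2 + y ^ 2) / y ≤ 1.2 := by rw [div_le_iff₀ hy]; linarith
  have l2 : 1.1 ≤ (x ^ 2 + y ^ 2) / y := by rw [le_div_iff₀ hy]; linarith
  have u3 : ((1 - x) ^ 2 + y ^ 2) / y ≤ 1.22565 := by rw [div_le_iff₀ hy]; linarith
  have l3 : 1.1 ≤ ((1 - x) ^ 2 + y ^ 2) / y := by rw [le_div_iff₀ hy]; linarith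
  exact ⟨abs_le.2 ⟨by linarith, by linarith⟩, abs_le.2 ⟨by linarith, by linarith⟩,
    abs_le.2 ⟨by linarith, by linarith⟩⟩

theorem near_hexagonal_sum_le {x y : ℝ} (hx : x ≤ 1 / 2) (hy1 : 0.866 ≤ y) (hy2 : y ≤ 0.8909)
    (hx1 : 0.4541 ≤ x) :
    1 / y + (x ^ 2 + y ^ 2) / y + ((1 - x) ^ 2 + y ^ 2) / y ≤ 2 * √3 + 0.0063 := by
  have hy : 0 < y := by linarith
  have s1 : 1.73205 ≤ √3 := Real.le_sqrt_of_sq_le (by norm_num)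
  have e : 1 / y + (x ^ 2 + y ^ 2) / y + ((1 - x) ^ 2 + y ^ 2) / y =
      2 * (1 - x * (1 - x) + y ^ 2) / y := by
    field_simp
    ring
  have hprod : 0 ≤ (y - 0.866) * (0.8909 - y) := mul_nonneg (by linarith) (by linarith)
  have hxx : 0.24789 ≤ x * (1 - x) := by nlinarith
  have h := mul_le_mul_of_nonneg_right s1 hy.le
  rw [e, div_le_iff₀ hy]
  linarith

/-- Near the hexagonal lattice the square lattice has a smaller value. -/
theorem latticeM_I_le_of_near_hexagonal {α : ℝ} (hα : 0 < α) (hα₁ : α < 0.9155730607) (z : ℍ)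
    (hx0 : 0 ≤ z.re) (hx : z.re ≤ 1 / 2) (hxy : 1 ≤ z.re ^ 2 + z.im ^ 2)
    (hω : z.im / α - α * z.im < 1 / (2 * Real.pi) - 0.0018) :
    latticeM α UpperHalfPlane.I ≤ latticeM α z := by
  have hy := z.im_pos
  obtain ⟨ha, hy1, hy2, hx1⟩ := near_hexagonal_bounds hα hα₁ hy hx0 hx hxy hω
  have hc : 2.868 ≤ Real.pi * α := by nlinarith [Real.pi_gt_d6]
  have hc' : Real.pi * α ≤ 2.8764 := by nlinarith [Real.pi_lt_d6]
  obtain ⟨q, h1, h2, h3⟩ := square_lt_hexagonal hc hc'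
  refine (latticeM_I_le hα h1 h2).trans (h3.trans ?_)
  refine le_trans ?_ (shells_le_latticeM hα z (fun q => q * Real.exp (-(Real.pi * α) * q))
    fun q => rfl)
  set x := z.re with hxdef
  set y := z.im with hydef
  obtain ⟨d1, d2, d3⟩ := near_hexagonal_first_shell hx hxy hy1 hy2 hx1
  have hH1 : 2 * (1 / y * ((x ^ 2 + y ^ 2) / y) +
      (x ^ 2 + y ^ 2) / y * (((1 - x) ^ 2 + y ^ 2) / y) + ((1 - x) ^ 2 + y ^ 2) / y * (1 / y)) -
      ((1 / y) ^ 2 + ((x ^ 2 + y ^ 2) / y) ^ 2 + (((1 - x) ^ 2 + y ^ 2) / y) ^ 2) = 4 := by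
    field_simp
    ring
  have hH2 : 2 * (((1 + x) ^ 2 + y ^ 2) / y * (((2 - x) ^ 2 + y ^ 2) / y) +
      ((2 - x) ^ 2 + y ^ 2) / y * (((1 - 2 * x) ^ 2 + 4 * y ^ 2) / y) +
      ((1 - 2 * x) ^ 2 + 4 * y ^ 2) / y * (((1 + x) ^ 2 + y ^ 2) / y)) -
      ((((1 + x) ^ 2 + y ^ 2) / y) ^ 2 + (((2 - x) ^ 2 + y ^ 2) / y) ^ 2 +
        (((1 - 2 * x) ^ 2 + 4 * y ^ 2) / y) ^ 2) = 36 := by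
    field_simp
    ring
  obtain ⟨σ, hσ⟩ : ∃ σ, σ = 1 / y + (x ^ 2 + y ^ 2) / y + ((1 - x) ^ 2 + y ^ 2) / y := ⟨_, rfl⟩
  have hσ1 : 2 * √3 ≤ σ := hσ ▸ two_sqrt_three_le (by positivity) hH1
  have hσ2 : σ ≤ 2 * √3 + 0.0063 := hσ ▸ near_hexagonal_sum_le hx hy1 hy2 hx1
  have f1 := first_shell_le hc hc' d1 d2 d3 hH1
  have f2 := second_shell_le (by linarith) hc' (by positivity) (by positivity) (by positivity)
    (by rw [hσ]; field_simp; ring) hσ1 hσ2 hH2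
  rw [← hσ] at f1
  -- `0.205 · 0.0063 < 0.0013`.
  have f3 : Real.exp (-(Real.pi * α) * (2 / √3)) * (2 * √3 - 0.0013) ≤
      Real.exp (-(Real.pi * α) * (2 / √3)) * (2 * √3 - 0.205 * (σ - 2 * √3)) :=
    mul_le_mul_of_nonneg_left (by linarith) (Real.exp_pos _).le
  linarith

/-! ### Small values of `α Im z` -/

/-- The Gaussian sum `∑ exp (-c n²)`. -/
noncomputable def gaussSum₀ (c : ℝ) : ℝ := ∑' n : ℤ, Real.exp (-c * (n : ℝ) ^ 2)

/-- The Gaussian moment `∑ n² exp (-c n²)`. -/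
noncomputable def gaussSum₂ (c : ℝ) : ℝ := ∑' n : ℤ, (n : ℝ) ^ 2 * Real.exp (-c * (n : ℝ) ^ 2)

theorem summable_gaussSum₀ {c : ℝ} (hc : 0 < c) :
    Summable fun n : ℤ => Real.exp (-c * (n : ℝ) ^ 2) := by
  have hpi := Real.pi_pos
  refine (summable_pow_mul_gaussian (div_pos hc hpi) 0).congr fun n => ?_
  rw [pow_zero, one_mul]
  congr 1
  field_simp

theorem summable_gaussSum₂ {c : ℝ} (hc : 0 < c) :
    Summable fun n : ℤ => (n : ℝ) ^ 2 * Real.exp (-c * (n : ℝ) ^ 2) := by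
  have hpi := Real.pi_pos
  refine (summable_pow_mul_gaussian (div_pos hc hpi) 2).congr fun n => ?_
  rw [sq_abs]
  congr 2
  field_simp

theorem one_le_gaussSum₀ {c : ℝ} (hc : 0 < c) : 1 ≤ gaussSum₀ c := by
  have h := (summable_gaussSum₀ hc).le_tsum 0 fun n _ => (Real.exp_pos _).le
  simpa [gaussSum₀] using h

theorem gaussSum₂_nonneg (c : ℝ) : 0 ≤ gaussSum₂ c := tsum_nonneg fun n => by positivity

/-- The theta functional equation `X ↦ 1/X`. With its second-moment analogue `sqrt_mul_gaussSum₂` it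
turns slowly converging sums at small `X` into nearly trivial ones. -/
theorem sqrt_mul_gaussSum₀ {X : ℝ} (hX : 0 < X) :
    √X * gaussSum₀ (Real.pi * X) = gaussSum₀ (Real.pi / X) := by
  have h := tsum_gaussian_shift hX 0
  simp only [zero_add, mul_zero, Real.cos_zero, mul_one] at h
  rw [tsum_mul_left] at h
  simp only [gaussSum₀]
  have e1 : ∀ n : ℤ, -(Real.pi * X) * (n : ℝ) ^ 2 = -Real.pi * X * (n : ℝ) ^ 2 := fun n => by ring
  have e2 : ∀ n : ℤ, -(Real.pi / X) * (n : ℝ) ^ 2 = -Real.pi / X * (n : ℝ) ^ 2 := fun n => by ring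
  simp only [e1, e2]
  rw [h, ← mul_assoc, mul_inv_cancel₀ (Real.sqrt_pos.2 hX).ne', one_mul]

theorem sqrt_mul_gaussSum₂ {X : ℝ} (hX : 0 < X) :
    √X * (X * gaussSum₂ (Real.pi * X)) = 1 / (2 * Real.pi) * gaussSum₀ (Real.pi / X) -
      1 / X * gaussSum₂ (Real.pi / X) := by
  have hpi := Real.pi_pos
  have h := tsum_sq_mul_gaussian_shift hX 0
  simp only [zero_add, mul_zero, Real.cos_zero, mul_one] at h
  rw [tsum_mul_left] at h
  simp only [gaussSum₂]
  have e1 : ∀ n : ℤ, -(Real.pi * X) * (n : ℝ) ^ 2 = -Real.pi * X * (n : ℝ) ^ 2 := fun n => by ring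
  simp only [e1]
  rw [h, gaussSum₀, mul_left_comm X, ← mul_assoc (√X), mul_inv_cancel₀ (Real.sqrt_pos.2 hX).ne',
    one_mul, ← tsum_mul_left, ← tsum_mul_left, ← tsum_mul_left,
    ← ((summable_gaussSum₀ (div_pos hpi hX)).mul_left _).tsum_sub
      ((summable_gaussSum₂ (div_pos hpi hX)).mul_left _)]
  refine tsum_congr fun n => ?_
  have e2 : -(Real.pi / X) * (n : ℝ) ^ 2 = -Real.pi / X * (n : ℝ) ^ 2 := by ring
  rw [e2]
  field_simp

theorem mul_exp_neg_pi_mul_le {u : ℝ} (hu : 3 ≤ u) : u * Real.exp (-(Real.pi * u)) ≤ 0.0025 := by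
  have h1 : u ≤ Real.exp u := (by linarith : u ≤ u + 1).trans (Real.add_one_le_exp u)
  have h2 : Real.exp (-6) ≤ 0.0025 := by
    have h3 : Real.exp (-6) * Real.exp 1 ^ 6 = 1 := by
      rw [← Real.exp_nat_mul, ← Real.exp_add]
      norm_num
    have h4 : (2.7182818283 : ℝ) ^ 6 ≤ Real.exp 1 ^ 6 := by
      have := Real.exp_one_gt_d9
      gcongr
    have h5 := mul_le_mul_of_nonneg_left h4 (Real.exp_pos (-6)).le
    rw [h3] at h5
    norm_num at h5 ⊢
    linarith
  calc u * Real.exp (-(Real.pi * u)) ≤ Real.exp u * Real.exp (-(Real.pi * u)) := by gcongr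
    _ = Real.exp (u - Real.pi * u) := by rw [← Real.exp_add]; ring_nf
    _ ≤ Real.exp (-6) := by
        apply Real.exp_le_exp.2
        nlinarith [Real.pi_gt_three]
    _ ≤ _ := h2

theorem gaussSum_bounds {u : ℝ} (hu : 3 ≤ u) :
    gaussSum₀ (Real.pi * u) ≤ 1.0051 ∧ u * gaussSum₂ (Real.pi * u) ≤ 0.0051 := by
  have hc : 0 < Real.pi * u := mul_pos Real.pi_pos (by linarith)
  have h := mul_exp_neg_pi_mul_le hu
  have hq : Real.exp (-(Real.pi * u)) ≤ 0.0025 / u := by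
    rw [le_div_iff₀ (by linarith)]
    linarith
  have hqs : 0.0025 / u ≤ 0.0025 := div_le_self (by norm_num) (by linarith)
  have hq1 : 4 * (0.0025 / u) ^ 3 ≤ 0.001 := by
    have : (0.0025 / u) ^ 3 ≤ 0.0025 ^ 3 := by gcongr
    norm_num at this ⊢
    linarith
  constructor
  · refine (tsum_gaussian_le hc (hq.trans hqs) (by norm_num)).2.trans ?_
    norm_num
  · have h2 := (tsum_sq_gaussian_le hc hq (by linarith)).2
    have h3 : 0.0025 / u / (1 - 4 * (0.0025 / u) ^ 3) ≤ 0.0025 / u / 0.999 := by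
      gcongr
      linarith
    have h4 : u * gaussSum₂ (Real.pi * u) ≤ u * (2 * (0.0025 / u / 0.999)) := by
      apply mul_le_mul_of_nonneg_left _ (by linarith)
      exact h2.trans (by linarith)
    refine h4.trans ?_
    have : u * (2 * (0.0025 / u / 0.999)) = 2 * 0.0025 / 0.999 := by
      field_simp
    rw [this]
    norm_num

theorem fourierCoeffM_eq (X Z m k : ℝ) : fourierCoeffM X Z m k =
    (1 / (2 * Real.pi) + X * m ^ 2 - Z * k ^ 2) *
      (Real.exp (-(Real.pi * X) * m ^ 2) * Real.exp (-(Real.pi * Z) * k ^ 2)) := by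
  rw [fourierCoeffM, ← Real.exp_add]
  congr 2
  ring

theorem hasSum_prod_gaussian {X Z : ℝ} (hX : 0 < X) (hZ : 0 < Z) (u v w : ℝ) :
    HasSum (fun p : ℤ × ℤ => (u + v * (p.1 : ℝ) ^ 2 + w * (p.2 : ℝ) ^ 2) *
      (Real.exp (-(Real.pi * X) * (p.1 : ℝ) ^ 2) * Real.exp (-(Real.pi * Z) * (p.2 : ℝ) ^ 2)))
      ((u * gaussSum₀ (Real.pi * X) + v * gaussSum₂ (Real.pi * X)) * gaussSum₀ (Real.pi * Z) +
        w * (gaussSum₀ (Real.pi * X) * gaussSum₂ (Real.pi * Z))) := by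
  have hpi := Real.pi_pos
  have x0 := summable_gaussSum₀ (mul_pos hpi hX)
  have x2 := summable_gaussSum₂ (mul_pos hpi hX)
  have z0 := summable_gaussSum₀ (mul_pos hpi hZ)
  have z2 := summable_gaussSum₂ (mul_pos hpi hZ)
  have n0 (c : ℝ) : 0 ≤ fun n : ℤ => Real.exp (-c * (n : ℝ) ^ 2) := fun n => (Real.exp_pos _).le
  have n2 (c : ℝ) : 0 ≤ fun n : ℤ => (n : ℝ) ^ 2 * Real.exp (-c * (n : ℝ) ^ 2) :=
    fun n => by positivity
  have a := (x0.hasSum.mul z0.hasSum (x0.mul_of_nonneg z0 (n0 _) (n0 _))).mul_left u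
  have b := (x2.hasSum.mul z0.hasSum (x2.mul_of_nonneg z0 (n2 _) (n0 _))).mul_left v
  have c := (x0.hasSum.mul z2.hasSum (x0.mul_of_nonneg z2 (n0 _) (n2 _))).mul_left w
  convert! (a.add b).add c using 1
  · funext p
    ring
  · simp only [gaussSum₀, gaussSum₂]
    ring

/-- An upper bound for the lattice sum of the rectangular lattice with `Im z = 1 / α`. -/
theorem sq_mul_latticeM_le {α : ℝ} (hα : 0 < α) (hα1 : α ≤ 1) (w : ℍ) (hre : w.re = 0)
    (him : w.im = 1 / α) : α ^ 2 * latticeM α w ≤ 0.283 := by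
  have hpi := Real.pi_pos
  have hX : α * w.im = 1 := by rw [him]; field_simp
  have hZ : 1 ≤ w.im / α := by
    rw [him, div_div, le_div_iff₀ (by positivity)]
    nlinarith
  rw [sq_mul_latticeM hα, hX, hre, Real.sqrt_one, one_mul]
  set Z := w.im / α with hZdef
  -- Discarding the nonpositive part `-Zk²` of the coefficients gives an upper bound that factors.
  have hs := hasSum_prod_gaussian one_pos (lt_of_lt_of_le one_pos hZ) (1 / (2 * Real.pi)) 1 0
  have hle : ∑' p : ℤ × ℤ, fourierCoeffM 1 Z p.1 p.2 * Real.cos (2 * Real.pi * p.1 * p.2 * 0) ≤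
      (1 / (2 * Real.pi) * gaussSum₀ (Real.pi * 1) + 1 * gaussSum₂ (Real.pi * 1)) *
        gaussSum₀ (Real.pi * Z) +
        0 * (gaussSum₀ (Real.pi * 1) * gaussSum₂ (Real.pi * Z)) := by
    rw [← hs.tsum_eq]
    refine (summable_fourierCoeffM_mul_cos one_pos (by linarith) 0).tsum_le_tsum (fun p => ?_)
      hs.summable
    rw [mul_zero, Real.cos_zero, mul_one, fourierCoeffM_eq]
    apply mul_le_mul_of_nonneg_right _ (by positivity)
    have : 0 ≤ Z * (p.2 : ℝ) ^ 2 := by positivity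
    linarith
  refine hle.trans ?_
  have hexp : Real.exp (-Real.pi) ≤ 0.0434 := by
    have h1 : Real.exp (-Real.pi) * Real.exp Real.pi = 1 := by rw [← Real.exp_add]; simp
    have h2 : (2.7182818283 : ℝ) ^ 3 * 1.1498 ≤ Real.exp Real.pi := by
      have e : Real.exp Real.pi = Real.exp 1 ^ 3 * Real.exp (Real.pi - 3) := by
        rw [← Real.exp_nat_mul, ← Real.exp_add]
        congr 1
        push_cast
        ring
      rw [e]
      have g := Real.exp_one_gt_d9
      have h3 := taylor_le_exp (x := 0.14) (by norm_num)
      have h4 : Real.exp 0.14 ≤ Real.exp (Real.pi - 3) :=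
        Real.exp_le_exp.2 (by linarith [Real.pi_gt_d2])
      gcongr
      refine le_trans ?_ (h3.trans h4)
      norm_num
    have h5 := mul_le_mul_of_nonneg_left h2 (Real.exp_pos (-Real.pi)).le
    rw [h1] at h5
    norm_num at h5 ⊢
    linarith
  have hexpZ : Real.exp (-(Real.pi * Z)) ≤ 0.0434 := by
    refine le_trans (Real.exp_le_exp.2 ?_) hexp
    nlinarith
  have g0 : gaussSum₀ (Real.pi * 1) ≤ 1.0869 := by
    refine (tsum_gaussian_le (by positivity) (by simpa using hexp) (by norm_num)).2.trans ?_
    norm_num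
  have g2 : gaussSum₂ (Real.pi * 1) ≤ 0.0869 := by
    refine (tsum_sq_gaussian_le (by positivity) (by simpa using hexp) (by norm_num)).2.trans ?_
    norm_num
  have gZ : gaussSum₀ (Real.pi * Z) ≤ 1.0869 := by
    refine (tsum_gaussian_le (by positivity) hexpZ (by norm_num)).2.trans ?_
    norm_num
  have hp : 1 / (2 * Real.pi) ≤ 0.1592 := by
    rw [div_le_iff₀ (by positivity)]
    linarith [Real.pi_gt_d4]
  have n2 := gaussSum₂_nonneg (Real.pi * 1)
  have n0 := one_le_gaussSum₀ (show 0 < Real.pi * 1 by positivity)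
  have nZ := one_le_gaussSum₀ (show 0 < Real.pi * Z by positivity)
  have hfirst : 1 / (2 * Real.pi) * gaussSum₀ (Real.pi * 1) + 1 * gaussSum₂ (Real.pi * 1) ≤
      0.1592 * 1.0869 + 1 * 0.0869 := by gcongr
  have := mul_le_mul hfirst gZ (by linarith) (by norm_num)
  rw [zero_mul, add_zero]
  refine this.trans ?_
  norm_num

/-- A lower bound for the lattice sum when `α Im z` is small. -/
theorem le_sq_mul_latticeM {α : ℝ} (hα : 0 < α) (z : ℍ) (hX : α * z.im ≤ 1 / 4)
    (hy : 3 / 4 ≤ z.im ^ 2) : 0.3 ≤ α ^ 2 * latticeM α z := by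
  have hpi := Real.pi_pos
  have hy0 := z.im_pos
  rw [sq_mul_latticeM hα]
  have hX0 : 0 < α * z.im := by positivity
  have hZ : 3 ≤ z.im / α := by
    rw [le_div_iff₀ hα]
    nlinarith
  set X := α * z.im with hXdef
  set Z := z.im / α with hZdef
  have hZ0 : 0 < Z := by linarith
  set p := 1 / (2 * Real.pi) with hp
  -- Each term is bounded below by minus the majorant `p + Xm² + Zk²` times its Gaussian. For `k =
  -- 0` the cosine is `1`, and adding twice `p + Xm²` restores the exact term.
  have hs := hasSum_prod_gaussian hX0 hZ0 (-p) (-X) (-Z)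
  have hs2 : HasSum (fun q : ℤ × ℤ => if q.2 = 0 then 2 * ((p + X * (q.1 : ℝ) ^ 2) *
      Real.exp (-(Real.pi * X) * (q.1 : ℝ) ^ 2)) else 0)
      (2 * (p * gaussSum₀ (Real.pi * X) + X * gaussSum₂ (Real.pi * X))) := by
    have h1 : HasSum (fun n : ℤ => 2 * ((p + X * (n : ℝ) ^ 2) *
        Real.exp (-(Real.pi * X) * (n : ℝ) ^ 2)))
        (2 * (p * gaussSum₀ (Real.pi * X) + X * gaussSum₂ (Real.pi * X))) := by
      convert! ((((summable_gaussSum₀ (mul_pos hpi hX0)).hasSum.mul_left p).add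
        ((summable_gaussSum₂ (mul_pos hpi hX0)).hasSum.mul_left X)).mul_left 2) using 1
      funext n
      ring
    have hi : Function.Injective fun n : ℤ => ((n, 0) : ℤ × ℤ) := fun a b h => by simpa using h
    refine (hi.hasSum_iff ?_).1 (by simpa [Function.comp_def] using h1)
    rintro ⟨a, b⟩ hab
    rw [if_neg]
    rintro rfl
    exact hab ⟨a, rfl⟩
  have hle := hs.add hs2
  have hlow : (-p * gaussSum₀ (Real.pi * X) + -X * gaussSum₂ (Real.pi * X)) *
      gaussSum₀ (Real.pi * Z) + -Z * (gaussSum₀ (Real.pi * X) * gaussSum₂ (Real.pi * Z)) +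
      2 * (p * gaussSum₀ (Real.pi * X) + X * gaussSum₂ (Real.pi * X)) ≤
      ∑' q : ℤ × ℤ, fourierCoeffM X Z q.1 q.2 * Real.cos (2 * Real.pi * q.1 * q.2 * z.re) := by
    rw [← hle.tsum_eq]
    refine hle.summable.tsum_le_tsum (fun q => ?_) (summable_fourierCoeffM_mul_cos hX0 hZ0 z.re)
    rw [fourierCoeffM_eq]
    by_cases hk : q.2 = 0
    · simp only [hk, Int.cast_zero, if_true, mul_zero, zero_mul, Real.cos_zero]
      norm_num
      apply le_of_eq
      ring
    · rw [if_neg hk, add_zero]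
      set G := Real.exp (-(Real.pi * X) * (q.1 : ℝ) ^ 2) *
        Real.exp (-(Real.pi * Z) * (q.2 : ℝ) ^ 2) with hG
      have hG0 : 0 ≤ G := by positivity
      have hp0 : 0 ≤ p := by positivity
      have h1 : |(p + X * (q.1 : ℝ) ^ 2 - Z * (q.2 : ℝ) ^ 2)| ≤
          p + X * (q.1 : ℝ) ^ 2 + Z * (q.2 : ℝ) ^ 2 := by
        have : 0 ≤ X * (q.1 : ℝ) ^ 2 := by positivity
        have : 0 ≤ Z * (q.2 : ℝ) ^ 2 := by positivity
        exact abs_le.2 ⟨by linarith, by linarith⟩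
      have h2 : |(p + X * (q.1 : ℝ) ^ 2 - Z * (q.2 : ℝ) ^ 2) * G *
          Real.cos (2 * Real.pi * q.1 * q.2 * z.re)| ≤
          (p + X * (q.1 : ℝ) ^ 2 + Z * (q.2 : ℝ) ^ 2) * G := by
        rw [abs_mul, abs_mul, abs_of_nonneg hG0]
        exact (mul_le_of_le_one_right (by positivity) (Real.abs_cos_le_one _)).trans
          (mul_le_mul_of_nonneg_right h1 hG0)
      have h3 := neg_le_of_abs_le h2
      linarith
  refine le_trans ?_ (mul_le_mul_of_nonneg_left hlow (Real.sqrt_nonneg X))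
  have e0 := sqrt_mul_gaussSum₀ hX0
  have e2 := sqrt_mul_gaussSum₂ hX0
  obtain ⟨z0, z2⟩ := gaussSum_bounds hZ
  have hu : 3 ≤ 1 / X := by
    rw [le_div_iff₀ hX0]
    linarith
  obtain ⟨x0, x2⟩ := gaussSum_bounds hu
  rw [mul_one_div] at x0 x2
  have hx1 := one_le_gaussSum₀ (div_pos hpi hX0)
  have hz1 := gaussSum₂_nonneg (Real.pi * Z)
  -- The exact contribution of `k = 0`. By the functional equation it is close to `2p = 1/π ≈
  -- 0.318`; since `Z ≥ 3`, the terms with `k ≠ 0` cost little.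
  set S := √X * (p * gaussSum₀ (Real.pi * X) + X * gaussSum₂ (Real.pi * X)) with hS
  have hSval : S = 2 * p * gaussSum₀ (Real.pi / X) - 1 / X * gaussSum₂ (Real.pi / X) := by
    rw [hS, mul_add, e2, ← e0]
    ring
  have hp1 : 0.159 ≤ p := by
    rw [hp, le_div_iff₀ (by positivity)]
    linarith [Real.pi_lt_d4]
  have hS1 : 0.3129 ≤ S := by
    rw [hSval]
    nlinarith
  have hfin : √X * ((-p * gaussSum₀ (Real.pi * X) + -X * gaussSum₂ (Real.pi * X)) *
      gaussSum₀ (Real.pi * Z) + -Z * (gaussSum₀ (Real.pi * X) * gaussSum₂ (Real.pi * Z)) +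
      2 * (p * gaussSum₀ (Real.pi * X) + X * gaussSum₂ (Real.pi * X))) =
      S * (2 - gaussSum₀ (Real.pi * Z)) -
        gaussSum₀ (Real.pi / X) * (Z * gaussSum₂ (Real.pi * Z)) := by
    rw [hS, ← e0]
    ring
  rw [hfin]
  have k1 : 0.3129 * 0.9949 ≤ S * (2 - gaussSum₀ (Real.pi * Z)) :=
    mul_le_mul hS1 (by linarith) (by norm_num) (by linarith)
  have k2 : gaussSum₀ (Real.pi / X) * (Z * gaussSum₂ (Real.pi * Z)) ≤ 1.0051 * 0.0051 :=
    mul_le_mul x0 z2 (mul_nonneg hZ0.le hz1) (by norm_num)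
  norm_num at k1 k2 ⊢
  linarith

/-! ### Monotonicity along horizontal lines -/

theorem abs_sin_nat_mul_le (n : ℕ) (t : ℝ) : |Real.sin (n * t)| ≤ n * |Real.sin t| := by
  induction n with
  | zero => simp
  | succ n ih =>
    push_cast
    rw [add_mul, one_mul, Real.sin_add, add_mul, one_mul]
    refine (abs_add_le _ _).trans (add_le_add ?_ ?_)
    · rw [abs_mul]
      exact (mul_le_of_le_one_right (abs_nonneg _) (Real.abs_cos_le_one _)).trans ih
    · rw [abs_mul]
      exact mul_le_of_le_one_left (abs_nonneg _) (Real.abs_cos_le_one _)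

/-- The difference is a product of two sines, and `|sin nt| ≤ n|sin t|` applies to each. Every
Fourier term thus varies by at most `(mk)²` times the variation of `cos 2πx`. -/
theorem abs_cos_nat_mul_sub_le (n : ℕ) (u v : ℝ) :
    |Real.cos (n * u) - Real.cos (n * v)| ≤ n ^ 2 * |Real.cos u - Real.cos v| := by
  rw [Real.cos_sub_cos, Real.cos_sub_cos]
  have e1 : ((n : ℝ) * u + n * v) / 2 = n * ((u + v) / 2) := by ring
  have e2 : ((n : ℝ) * u - n * v) / 2 = n * ((u - v) / 2) := by ring
  rw [e1, e2, abs_mul, abs_mul, abs_mul, abs_mul]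
  have h1 := abs_sin_nat_mul_le n ((u + v) / 2)
  have h2 := abs_sin_nat_mul_le n ((u - v) / 2)
  have h3 := mul_le_mul h1 h2 (abs_nonneg _) (by positivity)
  have h4 : (0 : ℝ) ≤ |(-2 : ℝ)| := abs_nonneg _
  have h5 := mul_le_mul_of_nonneg_left h3 h4
  calc _ = |(-2 : ℝ)| * (|Real.sin (n * ((u + v) / 2))| * |Real.sin (n * ((u - v) / 2))|) := by ring
    _ ≤ _ := h5
    _ = _ := by ring

/-- The difference of two values of the Fourier series along a horizontal line, as a sum over
positive indices. -/
theorem tsum_fourierCoeffM_sub {X Z : ℝ} (hX : 0 < X) (hZ : 0 < Z) (x₁ x₂ : ℝ) :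
    let f : ℕ × ℕ → ℝ := fun p => fourierCoeffM X Z (p.1 + 1) (p.2 + 1) *
      (Real.cos (2 * Real.pi * (p.1 + 1) * (p.2 + 1) * x₂) -
        Real.cos (2 * Real.pi * (p.1 + 1) * (p.2 + 1) * x₁))
    Summable f ∧
    (∑' p : ℤ × ℤ, fourierCoeffM X Z p.1 p.2 * Real.cos (2 * Real.pi * p.1 * p.2 * x₂)) -
      (∑' p : ℤ × ℤ, fourierCoeffM X Z p.1 p.2 * Real.cos (2 * Real.pi * p.1 * p.2 * x₁)) =
      4 * ∑' p, f p := by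
  intro f
  have h1 := summable_fourierCoeffM_mul_cos hX hZ x₁
  have h2 := summable_fourierCoeffM_mul_cos hX hZ x₂
  set F : ℤ × ℤ → ℝ := fun p => fourierCoeffM X Z p.1 p.2 *
    (Real.cos (2 * Real.pi * p.1 * p.2 * x₂) - Real.cos (2 * Real.pi * p.1 * p.2 * x₁)) with hF
  have hs : Summable F := (h2.sub h1).congr fun p => by rw [hF]; ring
  have hf : f = fun p : ℕ × ℕ => F ((p.1 : ℤ) + 1, (p.2 : ℤ) + 1) := by
    funext p
    simp [f, hF]
  have hfs : Summable f := by
    rw [hf]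
    exact hs.comp_injective (i := fun p : ℕ × ℕ => ((p.1 : ℤ) + 1, (p.2 : ℤ) + 1))
      fun a b h => by
        simp only [Prod.mk.injEq, add_left_inj, Nat.cast_inj] at h
        exact Prod.ext h.1 h.2
  refine ⟨hfs, ?_⟩
  have heq : (∑' p : ℤ × ℤ, fourierCoeffM X Z p.1 p.2 * Real.cos (2 * Real.pi * p.1 * p.2 * x₂)) -
      (∑' p : ℤ × ℤ, fourierCoeffM X Z p.1 p.2 * Real.cos (2 * Real.pi * p.1 * p.2 * x₁)) =
      ∑' p, F p := by
    rw [← h2.tsum_sub h1]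
    exact tsum_congr fun p => by rw [hF]; ring
  have hc : ∀ m k, fourierCoeffM X Z (-m) k = fourierCoeffM X Z m k := fun m k => by
    simp [fourierCoeffM]
  have hc' : ∀ m k, fourierCoeffM X Z m (-k) = fourierCoeffM X Z m k := fun m k => by
    simp [fourierCoeffM]
  have hcos : ∀ m k x : ℝ, Real.cos (2 * Real.pi * (-m) * k * x) =
      Real.cos (2 * Real.pi * m * k * x) := fun m k x => by
    rw [← Real.cos_neg]
    congr 1
    ring
  have hcos' : ∀ m k x : ℝ, Real.cos (2 * Real.pi * m * (-k) * x) =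
      Real.cos (2 * Real.pi * m * k * x) := fun m k x => by
    rw [← Real.cos_neg]
    congr 1
    ring
  have hev1 : ∀ m k, F (-m, k) = F (m, k) := fun m k => by
    simp only [hF]
    push_cast
    rw [hc, hcos, hcos]
  have hev2 : ∀ m k, F (m, -k) = F (m, k) := fun m k => by
    simp only [hF]
    push_cast
    rw [hc', hcos', hcos']
  -- Terms with `m = 0` or `k = 0` do not depend on `x`; evenness in `m` and in `k` yields the
  -- factor `4`.
  have hz1 : ∀ k, F (0, k) = 0 := fun k => by simp [hF]
  have hz2 : ∀ m, F (m, 0) = 0 := fun m => by simp [hF]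
  rw [heq, hs.tsum_prod, tsum_int_even _ (fun m => by simp only [hev1]) hs.prod]
  simp only [hz1, tsum_zero, zero_add]
  have hin : ∀ m : ℤ, ∑' k : ℤ, F (m, k) = 2 * ∑' j : ℕ, F (m, (j : ℤ) + 1) := fun m => by
    rw [tsum_int_even _ (fun k => hev2 m k) (hs.prod_factor m), hz2, zero_add]
  simp only [hin]
  rw [tsum_mul_left, hfs.tsum_prod, hf]
  ring

/-- If the terms of the difference are bounded below by those of a series with nonpositive sum, the
lattice sum is monotone. -/
theorem latticeM_le_of_majorant {α : ℝ} (hα : 0 < α) (z w : ℍ) (him : w.im = z.im)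
    {g : ℕ × ℕ → ℝ} {G C : ℝ} (hg : HasSum g G) (hG : G ≤ 0) (hC : 0 ≤ C)
    (h : ∀ p : ℕ × ℕ, -(fourierCoeffM (α * z.im) (z.im / α) (p.1 + 1) (p.2 + 1) *
      (Real.cos (2 * Real.pi * (p.1 + 1) * (p.2 + 1) * z.re) -
        Real.cos (2 * Real.pi * (p.1 + 1) * (p.2 + 1) * w.re))) ≤ C * g p) :
    latticeM α w ≤ latticeM α z := by
  have hy := z.im_pos
  obtain ⟨hs, he⟩ := tsum_fourierCoeffM_sub (X := α * z.im) (Z := z.im / α) (by positivity)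
    (by positivity) w.re z.re
  have h1 := hs.neg.tsum_le_tsum h (hg.mul_left C).summable
  rw [tsum_neg, (hg.mul_left C).tsum_eq] at h1
  have h2 : C * G ≤ 0 := mul_nonpos_of_nonneg_of_nonpos hC hG
  have h3 := sq_mul_latticeM hα z
  have h4 := sq_mul_latticeM hα w
  rw [him] at h4
  have h5 : 0 ≤ α ^ 2 * latticeM α z - α ^ 2 * latticeM α w := by
    rw [h3, h4, ← mul_sub, he]
    have : 0 ≤ √(α * z.im) := Real.sqrt_nonneg _
    apply mul_nonneg this
    linarith
  have h6 : 0 < α ^ 2 := by positivity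
  nlinarith

/-- Normalized weights `m² exp (-π t (m² - 1))`, with `m = i + 1`. -/
noncomputable def weight₀ (t : ℝ) (i : ℕ) : ℝ :=
  ((i : ℝ) + 1) ^ 2 * Real.exp (-Real.pi * t * (((i : ℝ) + 1) ^ 2 - 1))

/-- Normalized weights `t m² (m² - 1) exp (-π t (m² - 1))`, with `m = i + 1`. -/
noncomputable def weight₁ (t : ℝ) (i : ℕ) : ℝ :=
  t * (((i : ℝ) + 1) ^ 2 * (((i : ℝ) + 1) ^ 2 - 1)) *
    Real.exp (-Real.pi * t * (((i : ℝ) + 1) ^ 2 - 1))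

theorem weight₀_nonneg (t : ℝ) (i : ℕ) : 0 ≤ weight₀ t i := by
  unfold weight₀
  positivity

theorem weight₁_nonneg {t : ℝ} (ht : 0 ≤ t) (i : ℕ) : 0 ≤ weight₁ t i := by
  unfold weight₁
  have : (0 : ℝ) ≤ ((i : ℝ) + 1) ^ 2 - 1 := by nlinarith [(Nat.cast_nonneg i : (0 : ℝ) ≤ i)]
  positivity

/-- Equality holds at `i = 0` and `i = 1`, and successive ratios never exceed `6`. -/
theorem quartic_le_six_pow (i : ℕ) :
    ((i : ℝ) + 2) ^ 2 * (((i : ℝ) + 2) ^ 2 - 1) ≤ 12 * 6 ^ i := by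
  induction i with
  | zero => norm_num
  | succ i ih =>
    push_cast
    rw [pow_succ (6 : ℝ)]
    have hi : (0 : ℝ) ≤ i := i.cast_nonneg
    have : ((i : ℝ) + 1 + 2) ^ 2 * (((i : ℝ) + 1 + 2) ^ 2 - 1) ≤
        6 * (((i : ℝ) + 2) ^ 2 * (((i : ℝ) + 2) ^ 2 - 1)) := by
      have h : 0 ≤ ((i : ℝ) + 2) * (i + 3) * (5 * i ^ 2 + 11 * i) := by positivity
      nlinarith
    linarith

/-- `(i + 2)² - 1 ≥ 3 + 5i`, again because `i(i - 1) ≥ 0`. -/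
theorem exp_weight_le {t : ℝ} (ht : 0 < t) (i : ℕ) :
    Real.exp (-Real.pi * t * (((i : ℝ) + 2) ^ 2 - 1)) ≤
      Real.exp (-(3 * Real.pi * t)) * Real.exp (-(5 * Real.pi * t)) ^ i := by
  rw [← Real.exp_nat_mul, ← Real.exp_add]
  apply Real.exp_le_exp.2
  have h : (0 : ℝ) ≤ i * (i - 1) := by
    rcases i with _ | i
    · simp
    · push_cast
      have : (0 : ℝ) ≤ i := i.cast_nonneg
      nlinarith
  have := mul_nonneg (mul_pos Real.pi_pos ht).le h
  linarith

theorem weight₀_bound {t H : ℝ} (ht : 0 < t) (hH : Real.exp (-(5 * Real.pi * t)) ≤ H)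
    (hH1 : 6 * H < 1) : Summable (weight₀ t) ∧
      ∑' i, weight₀ t i ≤ 1 + 4 * (Real.exp (-(3 * Real.pi * t)) / (1 - 6 * H)) := by
  have hH0 : 0 < H := (Real.exp_pos _).trans_le hH
  have h := tsum_le_geometric (f := fun i => weight₀ t (i + 1))
    (A := 4 * Real.exp (-(3 * Real.pi * t))) (r := 6 * H) (fun i => weight₀_nonneg t _)
    (by positivity) hH1 fun i => by
      have h6 : ((i : ℝ) + 2) ^ 2 ≤ 4 * 6 ^ i := by
        have h4 := quartic_le_six_pow i
        have hi : (0 : ℝ) ≤ i := i.cast_nonneg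
        have h3 : (3 : ℝ) ≤ ((i : ℝ) + 2) ^ 2 - 1 := by nlinarith
        have : ((i : ℝ) + 2) ^ 2 * 3 ≤ ((i : ℝ) + 2) ^ 2 * (((i : ℝ) + 2) ^ 2 - 1) := by gcongr
        linarith
      have e : ((i : ℝ) + 1 + 1) = i + 2 := by ring
      simp only [weight₀]
      push_cast
      rw [e]
      calc ((i : ℝ) + 2) ^ 2 * Real.exp (-Real.pi * t * (((i : ℝ) + 2) ^ 2 - 1))
          ≤ (4 * 6 ^ i) * (Real.exp (-(3 * Real.pi * t)) * H ^ i) := by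
            refine mul_le_mul h6 ((exp_weight_le ht i).trans ?_) (Real.exp_pos _).le (by positivity)
            gcongr
        _ = _ := by rw [mul_pow]; ring
  have hs : Summable (weight₀ t) := (summable_nat_add_iff 1).1 h.1
  refine ⟨hs, ?_⟩
  rw [hs.tsum_eq_zero_add]
  have : weight₀ t 0 = 1 := by simp [weight₀]
  rw [this, ← mul_div_assoc]
  linarith [h.2]

theorem weight₁_bound {t H : ℝ} (ht : 0 < t) (hH : Real.exp (-(5 * Real.pi * t)) ≤ H)
    (hH1 : 6 * H < 1) : Summable (weight₁ t) ∧
      ∑' i, weight₁ t i ≤ 12 * (t * Real.exp (-(3 * Real.pi * t)) / (1 - 6 * H)) := by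
  have hH0 : 0 < H := (Real.exp_pos _).trans_le hH
  have h := tsum_le_geometric (f := fun i => weight₁ t (i + 1))
    (A := 12 * (t * Real.exp (-(3 * Real.pi * t)))) (r := 6 * H)
    (fun i => weight₁_nonneg ht.le _) (by positivity) hH1 fun i => by
      have e : ((i : ℝ) + 1 + 1) = i + 2 := by ring
      simp only [weight₁]
      push_cast
      rw [e]
      calc t * (((i : ℝ) + 2) ^ 2 * (((i : ℝ) + 2) ^ 2 - 1)) *
            Real.exp (-Real.pi * t * (((i : ℝ) + 2) ^ 2 - 1))
          ≤ (t * (12 * 6 ^ i)) * (Real.exp (-(3 * Real.pi * t)) * H ^ i) := by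
            refine mul_le_mul (mul_le_mul_of_nonneg_left (quartic_le_six_pow i) ht.le)
              ((exp_weight_le ht i).trans ?_) (Real.exp_pos _).le (by positivity)
            gcongr
        _ = _ := by rw [mul_pow]; ring
  have hs : Summable (weight₁ t) := (summable_nat_add_iff 1).1 h.1
  refine ⟨hs, ?_⟩
  rw [hs.tsum_eq_zero_add]
  have : weight₁ t 0 = 0 := by simp [weight₁]
  rw [this, ← mul_div_assoc]
  linarith [h.2]

/-- The factorization of the Fourier coefficients through the first one. -/
theorem fourierCoeffM_factor (X Z m k : ℝ) : fourierCoeffM X Z m k =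
    Real.exp (-Real.pi * (X + Z)) * ((X * (m ^ 2 - 1) - Z * (k ^ 2 - 1) -
      (Z - X - 1 / (2 * Real.pi))) * (Real.exp (-Real.pi * X * (m ^ 2 - 1)) *
        Real.exp (-Real.pi * Z * (k ^ 2 - 1)))) := by
  have : Real.exp (-Real.pi * (X * m ^ 2 + Z * k ^ 2)) = Real.exp (-Real.pi * (X + Z)) *
      (Real.exp (-Real.pi * X * (m ^ 2 - 1)) * Real.exp (-Real.pi * Z * (k ^ 2 - 1))) := by
    rw [← Real.exp_add, ← Real.exp_add]
    congr 1
    ring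
  rw [fourierCoeffM, this]
  ring

/-- The absolute majorant of the difference of two values along a horizontal line. -/
noncomputable def majorant (X Z ω : ℝ) (p : ℕ × ℕ) : ℝ :=
  |ω| * (weight₀ X p.1 * weight₀ Z p.2) + weight₁ X p.1 * weight₀ Z p.2 +
    weight₀ X p.1 * weight₁ Z p.2

theorem neg_term_le_majorant {X Z : ℝ} (hX : 0 < X) (hZ : 0 < Z) (x₁ x₂ : ℝ) (p : ℕ × ℕ) :
    -(fourierCoeffM X Z (p.1 + 1) (p.2 + 1) *
      (Real.cos (2 * Real.pi * (p.1 + 1) * (p.2 + 1) * x₂) -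
        Real.cos (2 * Real.pi * (p.1 + 1) * (p.2 + 1) * x₁))) ≤
      Real.exp (-Real.pi * (X + Z)) * |Real.cos (2 * Real.pi * x₁) - Real.cos (2 * Real.pi * x₂)| *
        majorant X Z (Z - X - 1 / (2 * Real.pi)) p := by
  have hcos := abs_cos_nat_mul_sub_le ((p.1 + 1) * (p.2 + 1)) (2 * Real.pi * x₂) (2 * Real.pi * x₁)
  push_cast at hcos
  have e (x : ℝ) : ((p.1 : ℝ) + 1) * (p.2 + 1) * (2 * Real.pi * x) =
      2 * Real.pi * (p.1 + 1) * (p.2 + 1) * x := by ring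
  rw [e, e, abs_sub_comm (Real.cos (2 * Real.pi * x₂))] at hcos
  rw [fourierCoeffM_factor]
  set ω := Z - X - 1 / (2 * Real.pi) with hω
  set m : ℝ := p.1 + 1 with hm
  set k : ℝ := p.2 + 1 with hk
  have hm1 : 0 ≤ m ^ 2 - 1 := by nlinarith [(Nat.cast_nonneg p.1 : (0 : ℝ) ≤ p.1)]
  have hk1 : 0 ≤ k ^ 2 - 1 := by nlinarith [(Nat.cast_nonneg p.2 : (0 : ℝ) ≤ p.2)]
  set A := Real.exp (-Real.pi * X * (m ^ 2 - 1)) with hA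
  set B := Real.exp (-Real.pi * Z * (k ^ 2 - 1)) with hB
  set E := Real.exp (-Real.pi * (X + Z)) with hE
  have hA0 : 0 < A := Real.exp_pos _
  have hB0 : 0 < B := Real.exp_pos _
  have hE0 : 0 < E := Real.exp_pos _
  have hmaj : majorant X Z ω p =
      (|ω| + X * (m ^ 2 - 1) + Z * (k ^ 2 - 1)) * (m ^ 2 * k ^ 2 * (A * B)) := by
    simp only [majorant, weight₀, weight₁, ← hm, ← hk, ← hA, ← hB]
    ring
  rw [hmaj]
  set Δ := |Real.cos (2 * Real.pi * x₁) - Real.cos (2 * Real.pi * x₂)| with hΔ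
  have hcoef : |X * (m ^ 2 - 1) - Z * (k ^ 2 - 1) - ω| ≤
      |ω| + X * (m ^ 2 - 1) + Z * (k ^ 2 - 1) := by
    have a := mul_nonneg hX.le hm1
    have b := mul_nonneg hZ.le hk1
    have c1 := le_abs_self ω
    have c2 := neg_abs_le ω
    exact abs_le.2 ⟨by linarith, by linarith⟩
  refine (neg_le_abs _).trans ?_
  rw [abs_mul, abs_mul, abs_mul, abs_of_pos hE0, abs_of_pos (mul_pos hA0 hB0)]
  have h1 := mul_le_mul hcoef hcos (abs_nonneg _) ((abs_nonneg _).trans hcoef)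
  have h2 := mul_le_mul_of_nonneg_left h1 (mul_pos hE0 (mul_pos hA0 hB0)).le
  calc _ = E * (A * B) * (|X * (m ^ 2 - 1) - Z * (k ^ 2 - 1) - ω| *
      |Real.cos (2 * Real.pi * m * k * x₂) - Real.cos (2 * Real.pi * m * k * x₁)|) := by ring
    _ ≤ _ := h2
    _ = _ := by ring

theorem hasSum_majorant {X Z : ℝ} (hX : 0 < X) (hZ : 0 < Z) (ω : ℝ) (x0 : Summable (weight₀ X))
    (x1 : Summable (weight₁ X)) (z0 : Summable (weight₀ Z)) (z1 : Summable (weight₁ Z)) :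
    HasSum (majorant X Z ω) (|ω| * ((∑' i, weight₀ X i) * ∑' i, weight₀ Z i) +
      (∑' i, weight₁ X i) * (∑' i, weight₀ Z i) + (∑' i, weight₀ X i) * ∑' i, weight₁ Z i) := by
  have n0 (t : ℝ) : 0 ≤ weight₀ t := weight₀_nonneg t
  have nX : 0 ≤ weight₁ X := weight₁_nonneg hX.le
  have nZ : 0 ≤ weight₁ Z := weight₁_nonneg hZ.le
  exact (((x0.hasSum.mul z0.hasSum (x0.mul_of_nonneg z0 (n0 X) (n0 Z))).mul_left |ω|).add
    (x1.hasSum.mul z0.hasSum (x1.mul_of_nonneg z0 nX (n0 Z)))).add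
    (x0.hasSum.mul z1.hasSum (x0.mul_of_nonneg z1 (n0 X) nZ))

theorem cos_two_pi_antitone {x₁ x₂ : ℝ} (h0 : 0 ≤ x₁) (h12 : x₁ ≤ x₂) (h2 : x₂ ≤ 1 / 2) :
    Real.cos (2 * Real.pi * x₂) ≤ Real.cos (2 * Real.pi * x₁) := by
  have hpi := Real.pi_pos
  apply Real.cos_le_cos_of_nonneg_of_le_pi (by positivity)
  · nlinarith
  · nlinarith

/-- The monotonicity criterion: the first term of the difference dominates the other ones, with an
optional improvement `c` for the term of index `(2, 1)`. -/
theorem latticeM_le_of_dominant {α : ℝ} (hα : 0 < α) (z w : ℍ) (him : w.im = z.im)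
    (hw0 : 0 ≤ w.re) (hwz : w.re ≤ z.re) (hz : z.re ≤ 1 / 2) {X Z ω c a₀ a₁ b₀ b₁ : ℝ}
    (hXdef : X = α * z.im) (hZdef : Z = z.im / α) (hω : ω = Z - X - 1 / (2 * Real.pi))
    (x0 : Summable (weight₀ X) ∧ ∑' i, weight₀ X i ≤ a₀)
    (x1 : Summable (weight₁ X) ∧ ∑' i, weight₁ X i ≤ a₁)
    (z0 : Summable (weight₀ Z) ∧ ∑' i, weight₀ Z i ≤ b₀)
    (z1 : Summable (weight₁ Z) ∧ ∑' i, weight₁ Z i ≤ b₁)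
    (h21 : -(fourierCoeffM X Z 2 1 * (Real.cos (2 * Real.pi * 2 * z.re) -
      Real.cos (2 * Real.pi * 2 * w.re))) ≤ Real.exp (-Real.pi * (X + Z)) *
        |Real.cos (2 * Real.pi * w.re) - Real.cos (2 * Real.pi * z.re)| *
        (majorant X Z ω (1, 0) + c))
    (hG : |ω| * (a₀ * b₀) + a₁ * b₀ + a₀ * b₁ + (-ω - |ω|) + c ≤ 0) :
    latticeM α w ≤ latticeM α z := by
  have hy := z.im_pos
  have hX : 0 < X := by rw [hXdef]; positivity
  have hZ : 0 < Z := by rw [hZdef]; positivity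
  -- Indices are shifted by one. At `(0, 0)`, that is `m = k = 1`, the crude `|ω|` is replaced by
  -- the true signed value `-ω`; at `(1, 0)`, that is `(m, k) = (2, 1)`, the correction `c` is
  -- added.
  have hsum := ((hasSum_majorant hX hZ ω x0.1 x1.1 z0.1 z1.1).add
    (hasSum_ite_eq ((0, 0) : ℕ × ℕ) (-ω - |ω|))).add (hasSum_ite_eq ((1, 0) : ℕ × ℕ) c)
  refine latticeM_le_of_majorant hα z w him hsum ?_
    (C := Real.exp (-Real.pi * (X + Z)) *
      |Real.cos (2 * Real.pi * w.re) - Real.cos (2 * Real.pi * z.re)|) (by positivity) ?_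
  · have n0 : 0 ≤ ∑' i, weight₀ X i := tsum_nonneg (weight₀_nonneg X)
    have n1 : 0 ≤ ∑' i, weight₁ X i := tsum_nonneg (weight₁_nonneg hX.le)
    have m0 : 0 ≤ ∑' i, weight₀ Z i := tsum_nonneg (weight₀_nonneg Z)
    have m1 : 0 ≤ ∑' i, weight₁ Z i := tsum_nonneg (weight₁_nonneg hZ.le)
    have k1 := mul_le_mul x0.2 z0.2 m0 (n0.trans x0.2)
    have k2 := mul_le_mul x1.2 z0.2 m0 (n1.trans x1.2)
    have k3 := mul_le_mul x0.2 z1.2 m1 (n0.trans x0.2)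
    have k4 := mul_le_mul_of_nonneg_left k1 (abs_nonneg ω)
    linarith
  · rintro ⟨i, j⟩
    rw [← hXdef, ← hZdef]
    by_cases h0 : (i, j) = (0, 0)
    · obtain ⟨rfl, rfl⟩ := Prod.mk.inj h0
      have hm : majorant X Z ω (0, 0) = |ω| := by simp [majorant, weight₀, weight₁]
      have hc := cos_two_pi_antitone hw0 hwz hz
      rw [fourierCoeffM_factor, ← hω, abs_of_nonneg (by linarith)]
      simp only [hm, if_true, Nat.cast_zero, zero_add, mul_one, one_pow, sub_self, mul_zero,
        zero_sub, Real.exp_zero, Prod.mk.injEq, zero_ne_one, false_and, if_false, add_zero]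
      apply le_of_eq
      ring
    · by_cases h1 : (i, j) = (1, 0)
      · obtain ⟨rfl, rfl⟩ := Prod.mk.inj h1
        rw [if_neg h0, if_pos h1, add_zero]
        simpa [one_add_one_eq_two] using h21
      · rw [if_neg h0, if_neg h1, add_zero, add_zero, hω]
        exact neg_term_le_majorant hX hZ w.re z.re (i, j)

theorem neg_two_one_term_le {X Z : ℝ} (hX : 0 < X) (hZ : 0 < Z) (x₁ x₂ : ℝ) :
    -(fourierCoeffM X Z 2 1 * (Real.cos (2 * Real.pi * 2 * x₂) -
      Real.cos (2 * Real.pi * 2 * x₁))) ≤ Real.exp (-Real.pi * (X + Z)) *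
        |Real.cos (2 * Real.pi * x₁) - Real.cos (2 * Real.pi * x₂)| *
        (majorant X Z (Z - X - 1 / (2 * Real.pi)) (1, 0) + 0) := by
  have h := neg_term_le_majorant hX hZ x₁ x₂ (1, 0)
  simpa [one_add_one_eq_two] using h

/-- By the double-angle formula this term is a multiple of `(C₁ - C₂)(C₁ + C₂)` with nonnegative
factor `3X - ω`, so it helps when the cosines are negative. The correction trades the majorant's
`(4|ω| + 12X)r` for `-2κ(3X - ω)r`. -/
theorem neg_two_one_term_le_of_cos {X Z ω κ : ℝ} {x₁ x₂ : ℝ}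
    (hω : ω = Z - X - 1 / (2 * Real.pi)) (hωX : ω ≤ 3 * X) (h0 : 0 ≤ x₁) (h12 : x₁ ≤ x₂)
    (h2 : x₂ ≤ 1 / 2)
    (hκ : Real.cos (2 * Real.pi * x₁) + Real.cos (2 * Real.pi * x₂) ≤ -κ) :
    -(fourierCoeffM X Z 2 1 * (Real.cos (2 * Real.pi * 2 * x₂) -
      Real.cos (2 * Real.pi * 2 * x₁))) ≤ Real.exp (-Real.pi * (X + Z)) *
        |Real.cos (2 * Real.pi * x₁) - Real.cos (2 * Real.pi * x₂)| *
        (majorant X Z ω (1, 0) + (-(2 * κ * (3 * X - ω) + 4 * |ω| + 12 * X) *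
          Real.exp (-(3 * Real.pi * X)))) := by
  have hc := cos_two_pi_antitone h0 h12 h2
  have e : ((1 : ℕ) : ℝ) + 1 = 2 := by norm_num
  have hr : Real.exp (-Real.pi * X * (2 ^ 2 - 1)) = Real.exp (-(3 * Real.pi * X)) := by
    congr 1
    ring
  have hm : majorant X Z ω (1, 0) = (4 * |ω| + 12 * X) * Real.exp (-(3 * Real.pi * X)) := by
    simp only [majorant, weight₀, weight₁, e, hr, Nat.cast_zero, zero_add, one_pow, sub_self,
      mul_zero, Real.exp_zero]
    ring
  have hd (x : ℝ) : Real.cos (2 * Real.pi * 2 * x) = 2 * Real.cos (2 * Real.pi * x) ^ 2 - 1 := by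
    rw [← Real.cos_two_mul]
    congr 1
    ring
  rw [hm, fourierCoeffM_factor, ← hω, hr, hd, hd, abs_of_nonneg (by linarith)]
  simp only [one_pow, sub_self, mul_zero, Real.exp_zero, mul_one, sub_zero]
  set E := Real.exp (-Real.pi * (X + Z))
  set r := Real.exp (-(3 * Real.pi * X))
  set C₁ := Real.cos (2 * Real.pi * x₁)
  set C₂ := Real.cos (2 * Real.pi * x₂)
  have hE : 0 < E := Real.exp_pos _
  have hr0 : 0 < r := Real.exp_pos _
  have hP : 0 ≤ E * r * (3 * X - ω) * (C₁ - C₂) * 2 :=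
    mul_nonneg (mul_nonneg (mul_nonneg (by positivity) (by linarith)) (by linarith)) (by norm_num)
  have := mul_le_mul_of_nonneg_left hκ hP
  linarith

/-! ### Numerical verification of the monotonicity criterion -/

theorem mul_exp_neg_antitone {a t₀ t : ℝ} (h : 1 ≤ a * t₀) (ht₀ : 0 < t₀) (ht : t₀ ≤ t) :
    t * Real.exp (-(a * t)) ≤ t₀ * Real.exp (-(a * t₀)) := by
  have h1 := Real.add_one_le_exp (a * (t - t₀))
  have h2 : t ≤ t₀ * Real.exp (a * (t - t₀)) := by
    have h3 := mul_le_mul_of_nonneg_left h1 ht₀.le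
    have h4 := mul_nonneg (sub_nonneg.2 h) (sub_nonneg.2 ht)
    linarith
  have h5 : Real.exp (-(a * t₀)) = Real.exp (a * (t - t₀)) * Real.exp (-(a * t)) := by
    rw [← Real.exp_add]
    congr 1
    ring
  rw [h5, ← mul_assoc]
  exact mul_le_mul_of_nonneg_right h2 (Real.exp_pos _).le

theorem exp_neg_three_pi_quarter : Real.exp (-(3 * Real.pi * (1 / 4))) ≤ 0.0949 := by
  have h0 : Real.exp (-(3 * Real.pi * (1 / 4))) ≤ Real.exp (-2.35619) :=
    Real.exp_le_exp.2 (by linarith [Real.pi_gt_d6])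
  refine h0.trans ?_
  have h1 := exp_le_taylor (x := 0.64381) (by norm_num) (by norm_num)
  have h2 := Real.exp_one_gt_d9
  have h3 : Real.exp (-2.35619) * Real.exp 1 ^ 3 = Real.exp 0.64381 := by
    rw [← Real.exp_nat_mul, ← Real.exp_add]
    norm_num
  have h4 : (2.7182818283 : ℝ) ^ 3 ≤ Real.exp 1 ^ 3 := by gcongr
  have h5 := mul_le_mul_of_nonneg_left h4 (Real.exp_pos (-2.35619)).le
  rw [h3] at h5
  norm_num at h1 h5 ⊢
  linarith

theorem exp_neg_five_pi_quarter : Real.exp (-(5 * Real.pi * (1 / 4))) ≤ 0.0236 := by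
  have h0 : Real.exp (-(5 * Real.pi * (1 / 4))) ≤ Real.exp (-3.75) :=
    Real.exp_le_exp.2 (by linarith [Real.pi_gt_three])
  refine h0.trans ?_
  have h1 := exp_le_taylor (x := 0.25) (by norm_num) (by norm_num)
  have h2 := Real.exp_one_gt_d9
  have h3 : Real.exp (-3.75) * Real.exp 1 ^ 4 = Real.exp 0.25 := by
    rw [← Real.exp_nat_mul, ← Real.exp_add]
    norm_num
  have h4 : (2.7182818283 : ℝ) ^ 4 ≤ Real.exp 1 ^ 4 := by gcongr
  have h5 := mul_le_mul_of_nonneg_left h4 (Real.exp_pos (-3.75)).le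
  rw [h3] at h5
  norm_num at h1 h5 ⊢
  linarith

theorem exp_neg_three_pi_Z : Real.exp (-(3 * Real.pi * 0.9458)) ≤ 0.0001346 := by
  have h0 : Real.exp (-(3 * Real.pi * 0.9458)) ≤ Real.exp (-8.9139) :=
    Real.exp_le_exp.2 (by linarith [Real.pi_gt_d6])
  refine h0.trans ?_
  have h1 := exp_le_taylor (x := 0.0861) (by norm_num) (by norm_num)
  have h2 := Real.exp_one_gt_d9
  have h3 : Real.exp (-8.9139) * Real.exp 1 ^ 9 = Real.exp 0.0861 := by
    rw [← Real.exp_nat_mul, ← Real.exp_add]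
    norm_num
  have h4 : (2.7182818283 : ℝ) ^ 9 ≤ Real.exp 1 ^ 9 := by gcongr
  have h5 := mul_le_mul_of_nonneg_left h4 (Real.exp_pos (-8.9139)).le
  rw [h3] at h5
  norm_num at h1 h5 ⊢
  linarith

theorem le_exp_neg_of_taylor {s x b : ℝ} (hx : 0 ≤ x) (hs : 3 * Real.pi * s ≤ 8 - x)
    (hb : b * 2.7182818286 ^ 8 ≤ 1 + x + x ^ 2 / 2) (hb0 : 0 ≤ b) :
    b ≤ Real.exp (-(3 * Real.pi * s)) := by
  have h0 : Real.exp (-(8 - x)) ≤ Real.exp (-(3 * Real.pi * s)) :=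
    Real.exp_le_exp.2 (by linarith)
  refine le_trans ?_ h0
  have h1 := Real.quadratic_le_exp_of_nonneg hx
  have h2 := Real.exp_one_lt_d9
  have h3 : Real.exp (-(8 - x)) * Real.exp 1 ^ 8 = Real.exp x := by
    rw [← Real.exp_nat_mul, ← Real.exp_add]
    congr 1
    push_cast
    ring
  have h4 : Real.exp 1 ^ 8 ≤ (2.7182818286 : ℝ) ^ 8 := by gcongr
  have h5 := mul_le_mul_of_nonneg_left h4 hb0
  have h6 : 0 < Real.exp 1 ^ 8 := by positivity
  rw [← mul_le_mul_iff_left₀ h6, h3]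
  linarith

/-- Bounds for the weight sums from bounds at a base point `t₀`. -/
theorem weight_bounds {t₀ t H r L : ℝ} (ht₀ : 1 / 4 ≤ t₀) (ht : t₀ ≤ t)
    (hH : Real.exp (-(5 * Real.pi * t₀)) ≤ H) (hr : Real.exp (-(3 * Real.pi * t₀)) ≤ r)
    (hH1 : 6 * H < 1) (hL : 1 / (1 - 6 * H) ≤ L) :
    (Summable (weight₀ t) ∧ ∑' i, weight₀ t i ≤ 1 + 4 * (r * L)) ∧
      (Summable (weight₁ t) ∧ ∑' i, weight₁ t i ≤ 12 * (t₀ * r * L)) := by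
  have hpi := Real.pi_gt_three
  have hpt : 5 * Real.pi * t₀ ≤ 5 * Real.pi * t := by gcongr
  have hpt3 : 3 * Real.pi * t₀ ≤ 3 * Real.pi * t := by gcongr
  have hH' : Real.exp (-(5 * Real.pi * t)) ≤ H :=
    (Real.exp_le_exp.2 (by linarith)).trans hH
  have hr' : Real.exp (-(3 * Real.pi * t)) ≤ r :=
    (Real.exp_le_exp.2 (by linarith)).trans hr
  have htr : t * Real.exp (-(3 * Real.pi * t)) ≤ t₀ * r :=
    (mul_exp_neg_antitone (a := 3 * Real.pi) (by nlinarith) (by linarith) ht).trans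
      (mul_le_mul_of_nonneg_left hr (by linarith))
  have ht0 : 0 < t := by linarith
  have hr0 : 0 < r := (Real.exp_pos _).trans_le hr
  have hL0 : 0 ≤ 1 / (1 - 6 * H) := div_nonneg zero_le_one (by linarith)
  obtain ⟨s0, b0⟩ := weight₀_bound ht0 hH' hH1
  obtain ⟨s1, b1⟩ := weight₁_bound ht0 hH' hH1
  refine ⟨⟨s0, b0.trans ?_⟩, ⟨s1, b1.trans ?_⟩⟩
  · rw [div_eq_mul_one_div]
    have := mul_le_mul hr' hL hL0 hr0.le
    linarith
  · rw [div_eq_mul_one_div]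
    have := mul_le_mul htr hL hL0 (by positivity)
    linarith

theorem exp_neg_mul_nat_quarter {a b : ℝ} (n : ℕ) (h : Real.exp (-(a * (1 / 4))) ≤ b) :
    Real.exp (-(a * (n / 4))) ≤ b ^ n := by
  have e : Real.exp (-(a * (n / 4))) = Real.exp (-(a * (1 / 4))) ^ n := by
    rw [← Real.exp_nat_mul]
    congr 1
    ring
  rw [e]
  gcongr

theorem weight_bounds_quarter {t : ℝ} (ht : 1 / 4 ≤ t) :
    (Summable (weight₀ t) ∧ ∑' i, weight₀ t i ≤ 1.4423) ∧
      (Summable (weight₁ t) ∧ ∑' i, weight₁ t i ≤ 0.3318) := by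
  obtain ⟨⟨s0, b0⟩, ⟨s1, b1⟩⟩ := weight_bounds (L := 1.165) le_rfl ht exp_neg_five_pi_quarter
    exp_neg_three_pi_quarter (by norm_num) (by norm_num)
  exact ⟨⟨s0, b0.trans (by norm_num)⟩, ⟨s1, b1.trans (by norm_num)⟩⟩

theorem weight_bounds_half {t : ℝ} (ht : 1 / 2 ≤ t) :
    (Summable (weight₀ t) ∧ ∑' i, weight₀ t i ≤ 1.0363) ∧
      (Summable (weight₁ t) ∧ ∑' i, weight₁ t i ≤ 0.0543) := by
  have h5 := exp_neg_mul_nat_quarter 2 exp_neg_five_pi_quarter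
  have h3 := exp_neg_mul_nat_quarter 2 exp_neg_three_pi_quarter
  norm_num at h5 h3
  obtain ⟨⟨s0, b0⟩, ⟨s1, b1⟩⟩ := weight_bounds (t₀ := 1 / 2) (L := 1.0034) (by norm_num) ht h5 h3
    (by norm_num) (by norm_num)
  exact ⟨⟨s0, b0.trans (by norm_num)⟩, ⟨s1, b1.trans (by norm_num)⟩⟩

theorem exp_neg_three_quarters :
    Real.exp (-(5 * Real.pi * (3 / 4))) ≤ 0.0000132 ∧
      Real.exp (-(3 * Real.pi * (3 / 4))) ≤ 0.000855 := by
  have h5 := exp_neg_mul_nat_quarter 3 exp_neg_five_pi_quarter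
  have h3 := exp_neg_mul_nat_quarter 3 exp_neg_three_pi_quarter
  norm_num at h5 h3 ⊢
  exact ⟨h5.trans (by norm_num), h3.trans (by norm_num)⟩

theorem weight_bounds_three_quarters {t : ℝ} (ht : 3 / 4 ≤ t) :
    (Summable (weight₀ t) ∧ ∑' i, weight₀ t i ≤ 1.00343) ∧
      (Summable (weight₁ t) ∧ ∑' i, weight₁ t i ≤ 0.0077) := by
  obtain ⟨⟨s0, b0⟩, ⟨s1, b1⟩⟩ := weight_bounds (L := 1.0001) (by norm_num) ht
    exp_neg_three_quarters.1 exp_neg_three_quarters.2 (by norm_num) (by norm_num)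
  exact ⟨⟨s0, b0.trans (by norm_num)⟩, ⟨s1, b1.trans (by norm_num)⟩⟩

theorem weight_bounds_Z {t : ℝ} (ht : 0.9458 ≤ t) :
    (Summable (weight₀ t) ∧ ∑' i, weight₀ t i ≤ 1.00054) ∧
      (Summable (weight₁ t) ∧ ∑' i, weight₁ t i ≤ 0.00153) := by
  have h5 : Real.exp (-(5 * Real.pi * 0.9458)) ≤ 0.0000132 :=
    (Real.exp_le_exp.2 (by linarith [Real.pi_pos])).trans exp_neg_three_quarters.1
  obtain ⟨⟨s0, b0⟩, ⟨s1, b1⟩⟩ := weight_bounds (L := 1.0001) (by norm_num) ht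
    h5 exp_neg_three_pi_Z (by norm_num) (by norm_num)
  exact ⟨⟨s0, b0.trans (by norm_num)⟩, ⟨s1, b1.trans (by norm_num)⟩⟩

theorem weight_bounds_self {t : ℝ} (ht : 3 / 4 ≤ t) :
    (Summable (weight₀ t) ∧
      ∑' i, weight₀ t i ≤ 1 + 4 * (Real.exp (-(3 * Real.pi * t)) * 1.0001)) ∧
      (Summable (weight₁ t) ∧
        ∑' i, weight₁ t i ≤ 12 * (t * Real.exp (-(3 * Real.pi * t)) * 1.0001)) := by
  have h5 : Real.exp (-(5 * Real.pi * t)) ≤ 0.0000132 := by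
    refine (Real.exp_le_exp.2 ?_).trans exp_neg_three_quarters.1
    have : 5 * Real.pi * (3 / 4) ≤ 5 * Real.pi * t := by
      have := Real.pi_pos
      gcongr
    linarith
  exact weight_bounds (L := 1.0001) (by linarith) le_rfl h5 le_rfl (by norm_num) (by norm_num)

theorem cos_two_pi_nonpos {x : ℝ} (h1 : 1 / 4 ≤ x) (h2 : x ≤ 1 / 2) :
    Real.cos (2 * Real.pi * x) ≤ 0 := by
  have hpi := Real.pi_pos
  apply Real.cos_nonpos_of_pi_div_two_le_of_le
  · nlinarith
  · nlinarith

theorem cos_two_pi_le {x : ℝ} (h1 : 0.409 ≤ x) (h2 : x ≤ 1 / 2) :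
    Real.cos (2 * Real.pi * x) ≤ -0.835 := by
  have hpi := Real.pi_lt_d4
  have hpi0 := Real.pi_pos
  have e : Real.cos (2 * Real.pi * x) = -Real.cos (2 * Real.pi * (1 / 2 - x)) := by
    rw [← Real.cos_pi_sub]
    congr 1
    ring
  have h := Real.one_sub_sq_div_two_le_cos (x := 2 * Real.pi * (1 / 2 - x))
  have hb : 2 * Real.pi * (1 / 2 - x) ≤ 0.5718 := by
    have : 2 * Real.pi * (1 / 2 - x) ≤ 2 * 3.1416 * 0.091 :=
      mul_le_mul (by linarith) (by linarith) (by linarith) (by norm_num)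
    linarith
  have hb0 : 0 ≤ 2 * Real.pi * (1 / 2 - x) := mul_nonneg (by positivity) (by linarith)
  rw [e]
  nlinarith

theorem one_div_two_pi_bounds : 0.15915 ≤ 1 / (2 * Real.pi) ∧ 1 / (2 * Real.pi) ≤ 0.15916 := by
  have hpi := Real.pi_pos
  constructor
  · rw [le_div_iff₀ (by positivity)]
    linarith [Real.pi_lt_d6]
  · rw [div_le_iff₀ (by positivity)]
    linarith [Real.pi_gt_d6]

/-- Monotonicity along horizontal lines when the leading coefficient is large. -/
theorem latticeM_le_of_large {α : ℝ} (hα : 0 < α) (z w : ℍ) (him : w.im = z.im)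
    (hw0 : 0 ≤ w.re) (hwz : w.re ≤ z.re) (hz : z.re ≤ 1 / 2) {X Z ω : ℝ}
    (hXdef : X = α * z.im) (hZdef : Z = z.im / α) (hω : ω = Z - X - 1 / (2 * Real.pi))
    (hXZ : 3 / 4 ≤ X * Z) (hZ : 0.9458 ≤ Z) (hX : 1 / 4 ≤ X) (hlarge : 0.011 ≤ ω) :
    latticeM α w ≤ latticeM α z := by
  obtain ⟨p1, p2⟩ := one_div_two_pi_bounds
  obtain ⟨z0, z1⟩ := weight_bounds_Z hZ
  have hX0 : 0 < X := by linarith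
  have h21 := hω ▸ neg_two_one_term_le hX0 (by linarith : 0 < Z) w.re z.re
  have habs : |ω| = ω := abs_of_nonneg (by linarith)
  rcases le_or_gt X (1 / 2) with h1 | h1
  · obtain ⟨x0, x1⟩ := weight_bounds_quarter hX
    refine latticeM_le_of_dominant hα z w him hw0 hwz hz hXdef hZdef hω x0 x1 z0 z1 h21 ?_
    -- As `XZ ≥ 3/4`, a small `X` forces a large `Z`, hence an `ω` large enough for the crude weight
    -- bounds.
    have hZ2 : 3 / 2 ≤ Z := by nlinarith
    rw [habs]
    linarith
  rcases le_or_gt X (3 / 4) with h2 | h2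
  · obtain ⟨x0, x1⟩ := weight_bounds_half h1.le
    refine latticeM_le_of_dominant hα z w him hw0 hwz hz hXdef hZdef hω x0 x1 z0 z1 h21 ?_
    have hZ2 : 1 ≤ Z := by nlinarith
    rw [habs]
    linarith
  · obtain ⟨x0, x1⟩ := weight_bounds_three_quarters h2.le
    refine latticeM_le_of_dominant hα z w him hw0 hwz hz hXdef hZdef hω x0 x1 z0 z1 h21 ?_
    rw [habs]
    linarith

/-- Monotonicity along horizontal lines when the leading coefficient is of intermediate size. -/
theorem latticeM_le_of_medium {α : ℝ} (hα : 0 < α) (z w : ℍ) (him : w.im = z.im)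
    (hw0 : 0 ≤ w.re) (hwz : w.re ≤ z.re) (hz : z.re ≤ 1 / 2) {X Z ω : ℝ}
    (hXdef : X = α * z.im) (hZdef : Z = z.im / α) (hω : ω = Z - X - 1 / (2 * Real.pi))
    (hZ : 0.9458 ≤ Z) (hX : 3 / 4 ≤ X) (hω1 : 0.002 ≤ ω) (hω2 : ω ≤ 0.011)
    (hx : 1 / 4 ≤ w.re) : latticeM α w ≤ latticeM α z := by
  obtain ⟨z0, z1⟩ := weight_bounds_Z hZ
  obtain ⟨x0, x1⟩ := weight_bounds_self hX
  have c1 := cos_two_pi_nonpos hx (hwz.trans hz)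
  have c2 := cos_two_pi_nonpos (hx.trans hwz) hz
  -- Beyond abscissa `1/4` both cosines are nonpositive, so the `(2, 1)` term costs nothing: `κ =
  -- 0`.
  have h21 := neg_two_one_term_le_of_cos (κ := 0) hω (by linarith) hw0 hwz hz (by linarith)
  refine latticeM_le_of_dominant hα z w him hw0 hwz hz hXdef hZdef hω x0 x1 z0 z1 h21 ?_
  rw [abs_of_nonneg (by linarith : 0 ≤ ω)]
  have hr : Real.exp (-(3 * Real.pi * X)) ≤ 0.000855 := by
    refine (Real.exp_le_exp.2 ?_).trans exp_neg_three_quarters.2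
    nlinarith [Real.pi_pos]
  have hXr : X * Real.exp (-(3 * Real.pi * X)) ≤ 0.75 * 0.000855 := by
    have h := mul_exp_neg_antitone (a := 3 * Real.pi) (t₀ := 3 / 4) (by linarith [Real.pi_gt_three])
      (by norm_num) hX
    have := exp_neg_three_quarters.2
    linarith
  have hr0 := Real.exp_pos (-(3 * Real.pi * X))
  set r := Real.exp (-(3 * Real.pi * X))
  have hωr : ω * r ≤ 0.000855 * ω := by nlinarith
  linarith

/-- Monotonicity along horizontal lines when the leading coefficient nearly vanishes. -/
theorem latticeM_le_of_small {α : ℝ} (hα : 0 < α) (z w : ℍ) (him : w.im = z.im)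
    (hw0 : 0 ≤ w.re) (hwz : w.re ≤ z.re) (hz : z.re ≤ 1 / 2) {X Z ω : ℝ}
    (hXdef : X = α * z.im) (hZdef : Z = z.im / α) (hω : ω = Z - X - 1 / (2 * Real.pi))
    (hZ : 0.9458 ≤ Z) (hX : 3 / 4 ≤ X) (hX1 : X ≤ 0.8355) (hω1 : -0.0018 ≤ ω) (hω2 : ω ≤ 0.002)
    (hωX : 0.825 ≤ X → 0 ≤ ω) (hx : 0.409 ≤ w.re) : latticeM α w ≤ latticeM α z := by
  obtain ⟨z0, z1⟩ := weight_bounds_Z hZ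
  obtain ⟨x0, x1⟩ := weight_bounds_self hX
  have c1 := cos_two_pi_le hx (hwz.trans hz)
  have c2 := cos_two_pi_le (hx.trans hwz) hz
  -- Now `-ω` may be positive, and the `(2, 1)` term must supply the gain: `κ = 2 · 0.835`.
  have h21 := neg_two_one_term_le_of_cos (κ := 1.67) hω (by linarith) hw0 hwz hz (by linarith)
  refine latticeM_le_of_dominant hα z w him hw0 hwz hz hXdef hZdef hω x0 x1 z0 z1 h21 ?_
  have hr : Real.exp (-(3 * Real.pi * X)) ≤ 0.000855 := by
    refine (Real.exp_le_exp.2 ?_).trans exp_neg_three_quarters.2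
    nlinarith [Real.pi_pos]
  have hXr : X * Real.exp (-(3 * Real.pi * X)) ≤ 0.75 * 0.000855 := by
    have h := mul_exp_neg_antitone (a := 3 * Real.pi) (t₀ := 3 / 4) (by linarith [Real.pi_gt_three])
      (by norm_num) hX
    have := exp_neg_three_quarters.2
    linarith
  have ha3 : 1 ≤ 3 * Real.pi * X := by nlinarith [Real.pi_gt_three]
  -- The gain is about `6κXr = 10.02 Xr`, so `Xr` is needed from below. Past `X = 0.825` the
  -- hypothesis `hωX` gives `ω ≥ 0`, and the weaker `hlow2` is enough.
  have hlow : X ≤ 0.825 → 0.825 * 0.000419 ≤ X * Real.exp (-(3 * Real.pi * X)) := fun h => by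
    have h1 := mul_exp_neg_antitone (a := 3 * Real.pi) ha3 (by linarith) h
    have h2 : 0.000419 ≤ Real.exp (-(3 * Real.pi * 0.825)) :=
      le_exp_neg_of_taylor (x := 0.2245) (by norm_num) (by linarith [Real.pi_lt_d6]) (by norm_num)
        (by norm_num)
    linarith
  have hlow2 : 0.8355 * 0.00038 ≤ X * Real.exp (-(3 * Real.pi * X)) := by
    have h1 := mul_exp_neg_antitone (a := 3 * Real.pi) ha3 (by linarith) hX1
    have h2 : 0.00038 ≤ Real.exp (-(3 * Real.pi * 0.8355)) :=
      le_exp_neg_of_taylor (x := 0.1255) (by norm_num) (by linarith [Real.pi_lt_d6]) (by norm_num)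
        (by norm_num)
    linarith
  have hr0 := Real.exp_pos (-(3 * Real.pi * X))
  set r := Real.exp (-(3 * Real.pi * X))
  have hs0 := abs_nonneg ω
  have hs1 : |ω| ≤ 0.002 := abs_le.2 ⟨by linarith, hω2⟩
  have hsr0 : 0 ≤ |ω| * r := by positivity
  have hsr : |ω| * r ≤ 0.002 * 0.000855 := mul_le_mul hs1 hr hr0.le (by norm_num)
  have hωr : ω * r ≤ 0.002 * 0.000855 := (mul_le_mul_of_nonneg_right (le_abs_self ω) hr0.le).trans hsr
  rcases le_or_gt X 0.825 with h | h
  · have := hlow h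
    linarith
  · have := hωX h.le
    linarith

/-! ### Assembling the regimes. -/

/-- Away from the hexagonal lattice, the lattice sum decreases when a point of the half fundamental
domain is moved to the left. -/
theorem latticeM_le_of_horizontal {α : ℝ} (hα : 0 < α) (hα₁ : α < 0.9155730607) (z w : ℍ)
    (him : w.im = z.im) (hw0 : 0 ≤ w.re) (hwz : w.re ≤ z.re) (hz : z.re ≤ 1 / 2)
    (hw : 1 ≤ w.re ^ 2 + z.im ^ 2) (hX : 1 / 4 ≤ α * z.im)
    (hω : 1 / (2 * Real.pi) - 0.0018 ≤ z.im / α - α * z.im) :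
    latticeM α w ≤ latticeM α z := by
  have hy := z.im_pos
  obtain ⟨p1, p2⟩ := one_div_two_pi_bounds
  obtain ⟨X, hXdef⟩ : ∃ X, X = α * z.im := ⟨_, rfl⟩
  obtain ⟨Z, hZdef⟩ : ∃ Z, Z = z.im / α := ⟨_, rfl⟩
  obtain ⟨ω, hωdef⟩ : ∃ ω, ω = Z - X - 1 / (2 * Real.pi) := ⟨_, rfl⟩
  have hXZ : X * Z = z.im ^ 2 := by
    rw [hXdef, hZdef]
    field_simp
  have hy2 : 3 / 4 ≤ z.im ^ 2 := by nlinarith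
  have hZ0 : 0 < Z := by rw [hZdef]; positivity
  -- `X/Z = α²`; combined with `XZ = y² ≥ 3/4` this also yields `Z ≥ 0.9458`.
  have hratio : X ≤ 0.838275 * Z := by
    have e : X = α ^ 2 * Z := by
      rw [hXdef, hZdef]
      field_simp
    rw [e]
    apply mul_le_mul_of_nonneg_right _ hZ0.le
    nlinarith
  rw [← hXdef] at hX
  rw [← hXdef, ← hZdef] at hω
  have hZ : 0.9458 ≤ Z := by nlinarith
  rcases le_or_gt 0.011 ω with h1 | h1
  · exact latticeM_le_of_large hα z w him hw0 hwz hz hXdef hZdef hωdef (by linarith) hZ hX h1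
  have hX2 : 3 / 4 ≤ X := by
    by_contra! h
    nlinarith
  rcases le_or_gt 0.002 ω with h2 | h2
  · refine latticeM_le_of_medium hα z w him hw0 hwz hz hXdef hZdef hωdef hZ hX2 h2 h1.le ?_
    have hXu : X ≤ 0.883 := by linarith
    have hZu : Z ≤ 1.0532 := by linarith
    -- Outside the unit disc `w.re² ≥ 1 - y² = 1 - XZ`, so bounding `XZ` above pushes `w` to the
    -- right.
    have : X * Z ≤ 0.883 * 1.0532 := mul_le_mul hXu hZu hZ0.le (by norm_num)
    nlinarith
  · have hXu : X ≤ 0.8355 := by linarith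
    have hZu : Z ≤ 0.9967 := by linarith
    -- For `X ≥ 0.825`, `hratio` gives `Z - X ≥ (1/0.838275 - 1)X ≥ 0.15916 ≥ 1/(2π)`, that is `ω ≥
    -- 0`.
    refine latticeM_le_of_small hα z w him hw0 hwz hz hXdef hZdef hωdef hZ hX2 hXu (by linarith)
      h2.le (fun h => by linarith) ?_
    have : X * Z ≤ 0.8355 * 0.9967 := mul_le_mul hXu hZu hZ0.le (by norm_num)
    nlinarith

/-- Every point of the closed half fundamental domain is dominated by a point of `Γ`. -/
theorem exists_gamma_latticeM_le {α : ℝ} (hα : 0 < α) (hα₁ : α < 0.9155730607) (z : ℍ)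
    (hx0 : 0 ≤ z.re) (hx : z.re ≤ 1 / 2) (hxy : 1 ≤ z.re ^ 2 + z.im ^ 2) :
    ∃ w ∈ gammaA ∪ gammaB, latticeM α w ≤ latticeM α z := by
  have hy := z.im_pos
  rcases le_or_gt (α * z.im) (1 / 4) with hX | hX
  · let w : ℍ := ⟨⟨0, 1 / α⟩, by change 0 < 1 / α; positivity⟩
    have hw1 : 1 ≤ w.im := by
      change 1 ≤ 1 / α
      rw [le_div_iff₀ hα]
      linarith
    refine ⟨w, Or.inl (mem_gammaA rfl hw1), ?_⟩
    have h1 := sq_mul_latticeM_le hα (by linarith) w rfl rfl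
    have h2 := le_sq_mul_latticeM hα z hX (by nlinarith)
    have h3 : 0 < α ^ 2 := by positivity
    nlinarith
  rcases lt_or_ge (z.im / α - α * z.im) (1 / (2 * Real.pi) - 0.0018) with hω | hω
  · refine ⟨UpperHalfPlane.I, Or.inl (mem_gammaA UpperHalfPlane.I_re UpperHalfPlane.I_im.ge), ?_⟩
    exact latticeM_I_le_of_near_hexagonal hα hα₁ z hx0 hx hxy hω
  rcases le_or_gt 1 z.im with h1 | h1
  · let w : ℍ := ⟨⟨0, z.im⟩, hy⟩
    refine ⟨w, Or.inl (mem_gammaA rfl h1), ?_⟩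
    refine latticeM_le_of_horizontal hα hα₁ z w rfl le_rfl hx0 hx ?_ hX.le hω
    change 1 ≤ (0 : ℝ) ^ 2 + z.im ^ 2
    nlinarith
  · have hs : 0 ≤ 1 - z.im ^ 2 := by nlinarith
    have hsq := Real.sq_sqrt hs
    let w : ℍ := ⟨⟨√(1 - z.im ^ 2), z.im⟩, hy⟩
    have hwz : w.re ≤ z.re := Real.sqrt_le_iff.2 ⟨hx0, by linarith⟩
    have hw0 : 0 ≤ w.re := Real.sqrt_nonneg _
    have hw1 : w.re ^ 2 + z.im ^ 2 = 1 := by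
      change √(1 - z.im ^ 2) ^ 2 + z.im ^ 2 = 1
      linarith
    exact ⟨w, Or.inr (mem_gammaB hw0 (hwz.trans hx) hw1),
      latticeM_le_of_horizontal hα hα₁ z w rfl hw0 hwz hx hw1.ge hX.le hω⟩

theorem proposition3p1 (α : ℝ) (hα₀ : 0 < α) (hα₁ : α < 0.9155730607) :
    ∃ μ : ℝ,
      IsLeast (Set.range (latticeM α)) μ ∧
      IsLeast (latticeM α '' closure halfFundamentalDomain) μ ∧
      IsLeast (latticeM α '' (gammaA ∪ gammaB)) μ :=
  exists_isLeast_of_dominated hα₀ (exists_gamma_latticeM_le hα₀ hα₁)
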